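/- Let $\Gamma$ be a finite subgroup of $\mathbf{SL}_3(\mathbb{C})$, let $\gamma_0,\dots,\gamma_l$ be representatives of the equivalence classes of irreducible finite-dimensional complex representations of $\Gamma$, with $\gamma_0$ the trivial one, let $\gamma$ be the natural representation of $\Gamma$ on $\mathbb{C}^3$, and let $\gamma^*$ be its contragredient. Define matrices $A^{(1)}=(a^{(1)}_{ij})$ and $A^{(2)}=(a^{(2)}_{ij})$ with non-negative integer entries, indexed by $0\le i,j\le l$, by the decompositions $$\gamma_j\otimes\gamma\cong\bigoplus_{i=0}^l a^{(1)}_{ij}\,\gamma_i,\qquad \gamma_j\otimes\gamma^*\cong\bigoplus_{i=0}^l a^{(2)}_{ij}\,\gamma_i .$$ Let $\varpi_1,\varpi_2$ be the fundamental weights of $\mathfrak{sl}_3(\mathbb{C})$ with respect to the diagonal Cartan subalgebra and the upper triangular Borel subalgebra, i.e. $\varpi_1(\mathrm{diag}(h_0,h_1,h_2))=h_0$ and $\varpi_2(\mathrm{diag}(h_0,h_1,h_2))=h_0+h_1$. For integers $m,n\ge 0$ let $V(m\varpi_1+n\varpi_2)$ be the simple finite-dimensional $\mathfrak{sl}_3(\mathbb{C})$-module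 of highest weight $m\varpi_1+n\varpi_2$, and let $\pi_{m,n}$ be the representation of $\mathbf{SL}_3(\mathbb{C})$ on it obtained by integration, i.e. such that $\pi_{m,n}(\exp X)$ is the exponential of the action of $X$ for every $X\in\mathfrak{sl}_3(\mathbb{C})$. Such a module and such a representation exist for all $m,n\ge 0$. Let $m_i(m,n)$ be the multiplicities in $$\pi_{m,n}|_\Gamma\cong\bigoplus_{i=0}^l m_i(m,n)\,\gamma_i,$$ and let $v_{m,n}=(m_0(m,n),\dots,m_l(m,n))\in\mathbb{C}^{l+1}$ for $m,n\ge 0$, and $v_{m,n}=0$ if $m<0$ or $n<0$. Then, for all integers $m,n\ge 0$, $$A^{(1)}v_{m,n}=v_{m+1,n}+v_{m,n-1}+v_{m-1,n+1},$$ $$A^{(2)}v_{m,n}=v_{m,n+1}+v_{m-1,n}+v_{m+1,n-1}.$$ -/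

import Mathlib

open scoped Matrix TensorProduct DirectSum

noncomputable section

/-- The group `SL₃(ℂ)`. -/
abbrev SL3 : Type := Matrix.SpecialLinearGroup (Fin 3) ℂ

/-- The Lie algebra `sl₃(ℂ)` of complex `3 × 3` matrices of trace zero. -/
abbrev sl3 := LieAlgebra.SpecialLinear.sl (Fin 3) ℂ

/-- The natural representation of `SL₃(ℂ)` on `ℂ³`: `g` acts by `x ↦ g x`. -/
def naturalRep : Representation ℂ SL3 (Fin 3 → ℂ) where
  toFun g := Matrix.toLin' (g : Matrix (Fin 3) (Fin 3) ℂ)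
  map_one' := by simp [Module.End.one_eq_id]
  map_mul' g h := by simp [Matrix.toLin'_mul, Module.End.mul_eq_comp]

/-- The exponential of an endomorphism of a finite-dimensional complex vector space, computed
through its matrix in a basis (the result does not depend on the basis). -/
def endExp {V : Type*} [AddCommGroup V] [Module ℂ V] [FiniteDimensional ℂ V]
    (T : Module.End ℂ V) : Module.End ℂ V :=
  Matrix.toLin (Module.finBasis ℂ V) (Module.finBasis ℂ V)
    (NormedSpace.exp (LinearMap.toMatrix (Module.finBasis ℂ V) (Module.finBasis ℂ V) T))

/-- `V` has a highest weight vector of weight `m ϖ₁ + n ϖ₂`: a nonzero vector killed by all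
strictly upper triangular matrices, on which a diagonal matrix `H = diag(h₀, h₁, h₂)` of trace zero
acts by the scalar `(m ϖ₁ + n ϖ₂)(H)`. Here the Cartan subalgebra consists of the diagonal
matrices, the positive root spaces are spanned by the elementary matrices above the diagonal, and
the fundamental weights are `ϖ₁(H) = h₀` and `ϖ₂(H) = h₀ + h₁`. -/
def HasHighestWeight (V : Type*) [AddCommGroup V] [Module ℂ V] [LieRingModule sl3 V]
    (m n : ℕ) : Prop :=
  ∃ v : V, v ≠ 0 ∧
    (∀ X : sl3, (∀ i j : Fin 3, j ≤ i → X.1 i j = 0) → ⁅X, v⁆ = 0) ∧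
    (∀ H : sl3, (∀ i j : Fin 3, i ≠ j → H.1 i j = 0) →
      ⁅H, v⁆ = ((m : ℂ) * H.1 0 0 + (n : ℂ) * (H.1 0 0 + H.1 1 1)) • v)

/-- The simple `sl₃(ℂ)`-module `V(m ϖ₁ + n ϖ₂)` together with the representation `π_{m,n}` of
`SL₃(ℂ)` obtained from it by integration. A term is a finite-dimensional simple
`sl₃(ℂ)`-module `V` of highest weight `m ϖ₁ + n ϖ₂`, with the representation `π` of `SL₃(ℂ)` on
`V` whose value at `exp X` is `exp` of the action of `X`, for every `X` in `sl₃(ℂ)`. -/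
structure HighestWeightRep (m n : ℕ) where
  /-- the underlying vector space -/
  V : Type
  [addCommGroup : AddCommGroup V]
  [module : Module ℂ V]
  [finiteDimensional : FiniteDimensional ℂ V]
  [lieRingModule : LieRingModule sl3 V]
  [lieModule : LieModule ℂ sl3 V]
  simple : LieModule.IsIrreducible ℂ sl3 V
  hasHighestWeight : HasHighestWeight V m n
  /-- the representation of the group -/
  π : Representation ℂ SL3 V
  integrates : ∀ (X : sl3) (g : SL3),
    (g : Matrix (Fin 3) (Fin 3) ℂ) = NormedSpace.exp (X : Matrix (Fin 3) (Fin 3) ℂ) →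
      π g = endExp (LieModule.toEnd ℂ sl3 V X)

attribute [instance] HighestWeightRep.addCommGroup HighestWeightRep.module
  HighestWeightRep.finiteDimensional HighestWeightRep.lieRingModule HighestWeightRep.lieModule

/-- A list `γ₀, …, γ_l` of representatives of all the equivalence classes of irreducible
finite-dimensional complex representations of `G`, each class occurring exactly once, with `γ₀`
the trivial representation. -/
structure IrrepList (G : Type) [Group G] (l : ℕ) where
  /-- the space of `γ_i` -/
  W : Fin (l + 1) → Type
  [addCommGroup : ∀ i, AddCommGroup (W i)]
  [module : ∀ i, Module ℂ (W i)]
  [finiteDimensional : ∀ i, FiniteDimensional ℂ (W i)]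
  /-- the representation `γ_i` -/
  γ : ∀ i, Representation ℂ G (W i)
  irreducible : ∀ i, (γ i).IsIrreducible
  trivial_zero : Nonempty ((γ 0).Equiv (Representation.trivial ℂ G ℂ))
  inequivalent : ∀ i j, Nonempty ((γ i).Equiv (γ j)) → i = j
  exhaustive : ∀ (U : Type) [AddCommGroup U] [Module ℂ U] [FiniteDimensional ℂ U]
    (σ : Representation ℂ G U), σ.IsIrreducible → ∃ i, Nonempty (σ.Equiv (γ i))

attribute [instance] IrrepList.addCommGroup IrrepList.module IrrepList.finiteDimensional

namespace IrrepList

variable {G : Type} [Group G] {l : ℕ} (S : IrrepList G l)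

/-- The representation `⨁ᵢ kᵢ γᵢ`. -/
def sum (k : Fin (l + 1) → ℕ) :
    Representation ℂ G (⨁ i, ⨁ _ : Fin (k i), S.W i) :=
  Representation.directSum fun i => Representation.directSum fun _ : Fin (k i) => S.γ i

/-- The multiplicities in the decomposition `σ ≅ ⨁ᵢ kᵢ γᵢ` of a representation `σ`. For a
finite-dimensional representation of a finite group such a family `k` exists by complete
reducibility, and it is unique. -/
def mult {U : Type} [AddCommGroup U] [Module ℂ U] (σ : Representation ℂ G U) :
    Fin (l + 1) → ℕ :=
  Classical.epsilon fun k => Nonempty (σ.Equiv (S.sum k))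

end IrrepList

section McKay

variable {Γ : Subgroup SL3} {l : ℕ} (S : IrrepList Γ l)

/-- The natural representation `γ` of a subgroup `Γ` of `SL₃(ℂ)` on `ℂ³`. -/
def gammaRep (Γ : Subgroup SL3) : Representation ℂ Γ (Fin 3 → ℂ) :=
  naturalRep.comp Γ.subtype

/-- The matrix `A⁽¹⁾`: its `(i, j)` entry is the multiplicity of `γᵢ` in `γⱼ ⊗ γ`. -/
def A1 : Matrix (Fin (l + 1)) (Fin (l + 1)) ℕ :=
  Matrix.of fun i j => S.mult ((S.γ j).tprod (gammaRep Γ)) i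

/-- The matrix `A⁽²⁾`: its `(i, j)` entry is the multiplicity of `γᵢ` in `γⱼ ⊗ γ*`. -/
def A2 : Matrix (Fin (l + 1)) (Fin (l + 1)) ℕ :=
  Matrix.of fun i j => S.mult ((S.γ j).tprod (gammaRep Γ).dual) i

/-- The vector `v_{a,b} ∈ ℂ^{l+1}` of the multiplicities of the `γᵢ` in the restriction of
`π_{a,b}` to `Γ`, for `a, b ≥ 0`, and `v_{a,b} = 0` when `a` or `b` is negative. -/
def multVec (P : ∀ m n : ℕ, HighestWeightRep m n) (a b : ℤ) : Fin (l + 1) → ℂ :=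
  if 0 ≤ a ∧ 0 ≤ b then
    fun i => (S.mult ((P a.toNat b.toNat).π.comp Γ.subtype) i : ℂ)
  else 0

end McKay

end

/-!
# McKay recursion for finite subgroups of `SL₃(ℂ)`

For a finite group, the multiplicities of the `γ_i` in a representation are linear functionals of
its character (`IrrepList.pairing_eq_mult`), and the matrices `A⁽¹⁾` and `A⁽²⁾` act on vectors of
multiplicities as multiplication of characters by those of `γ` and `γ*`
(`IrrepList.sum_mult_tprod_mul_mult`). Both identities therefore follow from Pieri's rule for the
characters of `π_{m,n}`, evaluated at elements of `Γ`. Such an element has finite order, so it is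
conjugate in `SL₃(ℂ)` to some `diag(t₀, t₁, t₂)` with `t₀ t₁ t₂ = 1`. The claim is that the
character of `π_{m,n}` takes there the value
`h_m(t) h_n(t⁻¹) - h_{m-1}(t) h_{n-1}(t⁻¹)`, with `h_k` the complete homogeneous symmetric
functions. Then Pieri's rule (`sum_mul_weylChar`, `sum_inv_mul_weylChar`) is the recursion
`h_{k+1} = e₁ h_k - e₂ h_{k-1} + e₃ h_{k-2}`, where `e₁ = ∑ t_i`, `e₂ = ∑ t_i⁻¹` and `e₃ = 1`.

To prove the claim and to construct the representations, take the polynomials in `x_i, y_i` that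
are of degree `m` in the coordinates `x_i` of `ℂ³`, of degree `n` in the dual coordinates `y_i`,
and killed by the contraction `∑ ∂²/∂x_i∂y_i` (`BiPoly.harm`). They contain the highest weight
vector `x₀ᵐ y₂ⁿ`. On them the quadratic Casimir operator is a scalar, while up to raising operators
it is diagonal on monomials, with the value of that scalar taken only at `x₀ᵐ y₂ⁿ`. This forces
irreducibility (`BiPoly.harm_isIrreducible`). Linear substitutions integrate the action of the Lie
algebra, because the exponential series of a derivation is multiplicative
(`BiPoly.harmRep_integrates`). The contraction maps bidegree `(m + 1, n + 1)` onto bidegree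
`(m, n)`, and the traces on spaces of bihomogeneous polynomials are visible on monomials. Additivity
of the trace on this exact sequence gives the character (`BiPoly.harmRep_character`).

Any other simple module of the same highest weight is isomorphic to the model: the submodule of the
product generated by the pair of highest weight vectors is the graph of an isomorphism
(`exists_linearEquiv_of_hasHighestWeight`). Since an element of finite order in `SL₃(ℂ)` is `exp X`
for some `X` in `sl₃(ℂ)` (`SL3.exists_exp_eq`), the isomorphism identifies the group actions there,
so the characters agree (`HighestWeightRep.character_eq`).
-/

/-! ### Multiplicities from characters -/

theorem LinearMap.trace_directSum_lmap {K ι : Type*} [Field K] [Fintype ι] [DecidableEq ι]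
    {V : ι → Type*} [∀ i, AddCommGroup (V i)] [∀ i, Module K (V i)]
    [∀ i, FiniteDimensional K (V i)] (f : ∀ i, V i →ₗ[K] V i) :
    LinearMap.trace K (⨁ i, V i) (DirectSum.lmap f) = ∑ i, LinearMap.trace K (V i) (f i) := by
  classical
  let b := fun i => Module.finBasis K (V i)
  let B : Module.Basis (Σ i, Fin (Module.finrank K (V i))) K (⨁ i, V i) := DFinsupp.basis b
  rw [LinearMap.trace_eq_matrix_trace K B, Matrix.trace, Fintype.sum_sigma]
  refine Finset.sum_congr rfl fun i _ => ?_
  rw [LinearMap.trace_eq_matrix_trace K (b i), Matrix.trace]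
  refine Finset.sum_congr rfl fun j _ => ?_
  have hr : ∀ (x : ⨁ i, V i) i j, B.repr x ⟨i, j⟩ = (b i).repr (x i) j := fun x i j => rfl
  have hB : B ⟨i, j⟩ = DirectSum.lof K ι V i (b i j) := by
    apply B.repr.injective
    rw [Module.Basis.repr_self]
    ext ⟨i', j'⟩
    rw [hr]
    obtain rfl | h := eq_or_ne i i'
    · rw [DirectSum.lof_apply, Module.Basis.repr_self]
      by_cases h : j = j' <;> simp [h]
    · rw [DirectSum.lof_eq_of, DirectSum.of_eq_of_ne _ _ _ h.symm]
      simp [h]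
  simp only [Matrix.diag_apply, LinearMap.toMatrix_apply]
  rw [hB, hr, DirectSum.lmap_lof, DirectSum.lof_apply]

theorem ofModule'_isIrreducible {G : Type} [Group G] (M : Type) [AddCommGroup M]
    [Module ℂ M] [Module (MonoidAlgebra ℂ G) M] [IsScalarTower ℂ (MonoidAlgebra ℂ G) M]
    [IsSimpleModule (MonoidAlgebra ℂ G) M] :
    (Representation.ofModule' (k := ℂ) (G := G) M).IsIrreducible := by
  rw [Representation.irreducible_iff_isSimpleModule_asModule]
  let τ := Representation.ofModule' (k := ℂ) (G := G) M
  have key : τ.asAlgebraHom = Algebra.lsmul ℂ ℂ M :=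
    (MonoidAlgebra.lift ℂ (M →ₗ[ℂ] M) G).apply_symm_apply _
  let e : τ.asModule ≃ₗ[MonoidAlgebra ℂ G] M :=
    { τ.asModuleEquiv.toAddEquiv with
      map_smul' := fun r x => by
        change τ.asModuleEquiv (r • x) = r • τ.asModuleEquiv x
        rw [Representation.asModuleEquiv_map_smul, key]; rfl }
  exact IsSimpleModule.congr e

namespace IrrepList

variable {G : Type} [Group G] {l : ℕ} (S : IrrepList G l)

/-- Complete reducibility: split `σ` into simple modules over the group algebra and sort these by
isomorphism class. -/
theorem exists_equiv_sum [Finite G] {U : Type} [AddCommGroup U] [Module ℂ U]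
    [FiniteDimensional ℂ U] (σ : Representation ℂ G U) :
    ∃ k, Nonempty (σ.Equiv (S.sum k)) := by
  classical
  have : NeZero (Nat.card G : ℂ) := ⟨by exact_mod_cast Nat.card_pos.ne'⟩
  have : IsSemisimpleModule (MonoidAlgebra ℂ G) σ.asModule :=
    (Representation.isSemisimpleRepresentation_iff_isSemisimpleModule_asModule σ).1 inferInstance
  have : Module.Finite (MonoidAlgebra ℂ G) σ.asModule :=
    Module.Finite.of_restrictScalars_finite ℂ _ _
  obtain ⟨n, N, e, hN⟩ :=
    IsSemisimpleModule.exists_linearEquiv_fin_dfinsupp (MonoidAlgebra ℂ G) σ.asModule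
  have hfin : ∀ i, FiniteDimensional ℂ (N i) := fun i =>
    FiniteDimensional.of_injective ((N i).subtype.restrictScalars ℂ) (N i).subtype_injective
  let ρ := fun i => Representation.ofModule' (k := ℂ) (G := G) (N i)
  have hc : ∀ i, ∃ j, Nonempty ((ρ i).Equiv (S.γ j)) := fun i =>
    S.exhaustive _ (ρ i) (ofModule'_isIrreducible (N i))
  choose c hc using hc
  let k : Fin (l + 1) → ℕ := fun j => Fintype.card {i // c i = j}
  let s : Fin n ≃ Σ j, Fin (k j) :=
    (Equiv.sigmaFiberEquiv c).symm.trans (Equiv.sigmaCongrRight fun j => Fintype.equivFin _)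
  have hs : ∀ p, c (s.symm p) = p.1 := fun p =>
    ((Fintype.equivFin {i // c i = p.1}).symm p.2).2
  have hf : ∀ p : Σ j, Fin (k j), Nonempty ((ρ (s.symm p)).Equiv (S.γ p.1)) := fun p => by
    rw [← hs p]; exact hc _
  let f := fun p => (hf p).some
  let E₁ : U ≃ₗ[ℂ] ⨁ i, N i := σ.asModuleEquiv.symm.trans (e.restrictScalars ℂ)
  let E₂ : (⨁ i, N i) ≃ₗ[ℂ] ⨁ p, N (s.symm p) := DirectSum.lequivCongrLeft ℂ s
  let E₃ : (⨁ p, N (s.symm p)) ≃ₗ[ℂ] ⨁ p : Σ j, Fin (k j), S.W p.1 :=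
    DFinsupp.mapRange.linearEquiv fun p => (f p).toLinearEquiv
  let E₄ : (⨁ p : Σ j, Fin (k j), S.W p.1) ≃ₗ[ℂ] ⨁ j, ⨁ _ : Fin (k j), S.W j :=
    DirectSum.sigmaLcurryEquiv ℂ (δ := fun j (_ : Fin (k j)) => S.W j)
  have hE : ∀ u j t, (E₄ (E₃ (E₂ (E₁ u)))) j t = f ⟨j, t⟩ ((E₁ u) (s.symm ⟨j, t⟩)) :=
    fun u j t => rfl
  have hE₁ : ∀ g u i, E₁ (σ g u) i = ρ i g (E₁ u i) := fun g u i => by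
    change e (σ.asModuleEquiv.symm (σ g u)) i = MonoidAlgebra.single g (1 : ℂ) • _
    rw [Representation.asModuleEquiv_symm_map_rho, map_smul]
    rfl
  refine ⟨k, ⟨Representation.Equiv.mk (((E₁.trans E₂).trans E₃).trans E₄) fun g => ?_⟩⟩
  ext u j t
  simp only [LinearMap.comp_apply, LinearEquiv.coe_coe, LinearEquiv.trans_apply]
  rw [hE, hE₁]
  exact Representation.IntertwiningMap.isIntertwining _ _ (f ⟨j, t⟩).toIntertwiningMap g _

theorem character_sum (k : Fin (l + 1) → ℕ) (g : G) :
    (S.sum k).character g = ∑ i, (k i : ℂ) * (S.γ i).character g := by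
  have h : (S.sum k).character g = LinearMap.trace ℂ (⨁ i, ⨁ _ : Fin (k i), S.W i)
      (DirectSum.lmap fun i => DirectSum.lmap fun _ : Fin (k i) => S.γ i g) := rfl
  rw [h, LinearMap.trace_directSum_lmap]
  refine Finset.sum_congr rfl fun i _ => ?_
  rw [LinearMap.trace_directSum_lmap]
  simp [Representation.character]

/-- Summing the decomposition that defines `mult` over characters. -/
theorem character_eq_sum_mult [Finite G] {U : Type} [AddCommGroup U] [Module ℂ U]
    [FiniteDimensional ℂ U] (σ : Representation ℂ G U) (g : G) :
    σ.character g = ∑ i, (S.mult σ i : ℂ) * (S.γ i).character g := by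
  obtain ⟨e⟩ : Nonempty (σ.Equiv (S.sum (S.mult σ))) :=
    Classical.epsilon_spec (p := fun k => Nonempty (σ.Equiv (S.sum k))) (S.exists_equiv_sum σ)
  rw [Representation.char_iso e, S.character_sum]

/-- The pairing of a function on `G` with the character of `γ_i`. -/
noncomputable def pairing [Fintype G] (i : Fin (l + 1)) : (G → ℂ) →ₗ[ℂ] ℂ where
  toFun f := (Nat.card G : ℂ)⁻¹ * ∑ g, f g * (S.γ i).character g⁻¹
  map_add' f f' := by simp [add_mul, Finset.sum_add_distrib, mul_add]
  map_smul' c f := by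
    simp only [Pi.smul_apply, smul_eq_mul, RingHom.id_apply, mul_assoc, ← Finset.mul_sum]
    ring

theorem pairing_character [Fintype G] (i j : Fin (l + 1)) :
    S.pairing i (S.γ j).character = if i = j then 1 else 0 := by
  classical
  have := S.irreducible i
  have := S.irreducible j
  have : Invertible (Nat.card G : ℂ) :=
    invertibleOfNonzero (by exact_mod_cast Nat.card_pos.ne')
  have h := Representation.char_orthonormal (S.γ j) (S.γ i)
  change (Nat.card G : ℂ)⁻¹ * ∑ g, _ = _
  rw [h]
  refine if_congr ⟨S.inequivalent i j, ?_⟩ rfl rfl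
  rintro rfl
  exact ⟨Representation.Equiv.refl _⟩

/-- Multiplicities are computed by orthogonality of characters. -/
theorem pairing_eq_mult [Fintype G] {U : Type} [AddCommGroup U] [Module ℂ U]
    [FiniteDimensional ℂ U] (σ : Representation ℂ G U) (i : Fin (l + 1)) :
    S.pairing i σ.character = S.mult σ i := by
  have h : σ.character = ∑ j, (S.mult σ j : ℂ) • (S.γ j).character := by
    ext g
    simp [S.character_eq_sum_mult σ g, Finset.sum_apply]
  rw [h, map_sum]
  simp [pairing_character]

/-- Tensoring with `τ` acts on multiplicities by the matrix of multiplicities of the `γ_i` in the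
`γ_j ⊗ τ`. -/
theorem sum_mult_tprod_mul_mult [Fintype G] {U T : Type} [AddCommGroup U] [Module ℂ U]
    [FiniteDimensional ℂ U] [AddCommGroup T] [Module ℂ T] [FiniteDimensional ℂ T]
    (σ : Representation ℂ G U) (τ : Representation ℂ G T) (i : Fin (l + 1)) :
    ∑ j, (S.mult ((S.γ j).tprod τ) i : ℂ) * S.mult σ j =
      S.pairing i (σ.character * τ.character) := by
  have h : σ.character * τ.character =
      ∑ j, (S.mult σ j : ℂ) • ((S.γ j).tprod τ).character := by
    ext g
    simp [S.character_eq_sum_mult σ g, Finset.sum_apply, Finset.sum_mul, mul_assoc]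
  rw [h, map_sum]
  exact Finset.sum_congr rfl fun j _ => by
    rw [map_smul, pairing_eq_mult, smul_eq_mul, mul_comm]

end IrrepList

/-! ### Exponentials -/

theorem Matrix.hasSum_exp {ι : Type*} [Fintype ι] [DecidableEq ι] (A : Matrix ι ι ℂ) :
    HasSum (fun k : ℕ => (k.factorial : ℂ)⁻¹ • A ^ k) (NormedSpace.exp A) := by
  let : NormedRing (Matrix ι ι ℂ) := Matrix.linftyOpNormedRing
  let : NormedAlgebra ℂ (Matrix ι ι ℂ) := Matrix.linftyOpNormedAlgebra
  exact NormedSpace.exp_series_hasSum_exp' (𝕂 := ℂ) A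

/-- `endExp T` is the exponential series of `T`, tested against linear functionals. -/
theorem hasSum_endExp {V : Type*} [AddCommGroup V] [Module ℂ V] [FiniteDimensional ℂ V]
    (T : Module.End ℂ V) (φ : V →ₗ[ℂ] ℂ) (v : V) :
    HasSum (fun k : ℕ => (k.factorial : ℂ)⁻¹ * φ ((T ^ k) v)) (φ (endExp T v)) := by
  let b := Module.finBasis ℂ V
  let L : Matrix _ _ ℂ →ₗ[ℂ] ℂ :=
    φ ∘ₗ LinearMap.applyₗ v ∘ₗ (Matrix.toLin b b).toLinearMap
  have hL : Continuous L := L.continuous_of_finiteDimensional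
  have h := (Matrix.hasSum_exp (LinearMap.toMatrix b b T)).map L hL
  refine h.congr_fun ?_
  intro k
  simp [L]

theorem endExp_conj {V W : Type*} [AddCommGroup V] [Module ℂ V] [FiniteDimensional ℂ V]
    [AddCommGroup W] [Module ℂ W] [FiniteDimensional ℂ W] (e : V ≃ₗ[ℂ] W) (T : Module.End ℂ V) :
    endExp (e.conj T) = e.conj (endExp T) := by
  ext w
  rw [← sub_eq_zero, ← Module.forall_dual_apply_eq_zero_iff ℂ]
  intro φ
  rw [map_sub, sub_eq_zero]
  have h₁ := hasSum_endExp (e.conj T) φ w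
  have h₂ := hasSum_endExp T (φ ∘ₗ e.toLinearMap) (e.symm w)
  refine h₁.unique ?_
  change HasSum _ (φ (e.conj (endExp T) w)) at h₂
  convert h₂ using 3 with k
  have : (e.conj T) ^ k = e.conj (T ^ k) := (map_pow (LinearEquiv.conjRingEquiv e) T k).symm
  rw [this]; rfl

/-! ### Diagonalizing elements of finite order -/

theorem Matrix.exists_mul_eq_mul_diagonal_of_pow_eq_one {n : Type*} [Fintype n] [DecidableEq n]
    (A : Matrix n n ℂ) {k : ℕ} (hk : k ≠ 0) (hA : A ^ k = 1) :
    ∃ (P : Matrix n n ℂ) (t : n → ℂ), P.det ≠ 0 ∧ A * P = P * Matrix.diagonal t := by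
  let f : Module.End ℂ (n → ℂ) := Matrix.toLin' A
  have hss : f.IsSemisimple := by
    apply Module.End.isSemisimple_of_squarefree_aeval_eq_zero (p := Polynomial.X ^ k - 1)
    · exact (Polynomial.separable_X_pow_sub_C 1 (by exact_mod_cast hk) one_ne_zero).squarefree
    · simp [f, ← Matrix.toLin'_pow, hA, Module.End.one_eq_id]
  let s : Set (n → ℂ) := {v | ∃ μ : ℂ, f v = μ • v}
  have hs : Submodule.span ℂ s = ⊤ := by
    rw [eq_top_iff, ← hss.iSup_eigenspace_eq_top]
    exact iSup_le fun μ v hv => Submodule.subset_span ⟨μ, Module.End.mem_eigenspace_iff.1 hv⟩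
  obtain ⟨b, hb, hspan, hli⟩ := exists_linearIndependent ℂ s
  let B₀ : Module.Basis b ℂ (n → ℂ) := Module.Basis.mk hli (by simp [hspan, hs])
  let B := B₀.reindex (B₀.indexEquiv (Pi.basisFun ℂ n))
  have hB : ∀ j, ∃ μ : ℂ, f (B j) = μ • B j := fun j => by
    obtain ⟨μ, hμ⟩ := hb ((B₀.indexEquiv (Pi.basisFun ℂ n)).symm j).2
    exact ⟨μ, by simpa [B, B₀] using hμ⟩
  choose t ht using hB
  refine ⟨(Pi.basisFun ℂ n).toMatrix B, t, ?_, ?_⟩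
  · rw [← Module.Basis.det_apply]
    exact ((Pi.basisFun ℂ n).isUnit_det B).ne_zero
  · ext i j
    have := congrFun (ht j) i
    simp only [f, Matrix.toLin'_apply, Matrix.mulVec, dotProduct, Pi.smul_apply,
      smul_eq_mul] at this
    simp [Matrix.mul_apply, Matrix.diagonal_apply, Module.Basis.toMatrix_apply, this, mul_comm]

namespace SL3

/-- An element of finite order is diagonalizable by a matrix of determinant `1`. -/
theorem exists_conj_diagonal (g : SL3) (hg : IsOfFinOrder g) :
    ∃ (h d : SL3) (t : Fin 3 → ℂ), g = h * d * h⁻¹ ∧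
      (d : Matrix (Fin 3) (Fin 3) ℂ) = Matrix.diagonal t := by
  obtain ⟨k, hk, hgk⟩ := isOfFinOrder_iff_pow_eq_one.1 hg
  obtain ⟨P, t, hP, hPt⟩ := Matrix.exists_mul_eq_mul_diagonal_of_pow_eq_one
    (g : Matrix (Fin 3) (Fin 3) ℂ) hk.ne' (by rw [← Matrix.SpecialLinearGroup.coe_pow, hgk]; rfl)
  have ht : (Matrix.diagonal t).det = 1 := by
    have := congrArg Matrix.det hPt
    rw [Matrix.det_mul, Matrix.det_mul, g.2, one_mul] at this
    exact (mul_left_cancel₀ hP (by rw [mul_one]; exact this)).symm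
  let d : SL3 := ⟨Matrix.diagonal t, ht⟩
  -- Rescaling one eigenvector makes the determinant of the change of basis equal to `1`.
  let D : Matrix (Fin 3) (Fin 3) ℂ := Matrix.diagonal ![P.det⁻¹, 1, 1]
  let h : SL3 := ⟨P * D, by simp [D, Matrix.det_mul, Fin.prod_univ_three, hP]⟩
  refine ⟨h, d, t, ?_, rfl⟩
  rw [eq_mul_inv_iff_mul_eq]
  apply Subtype.ext
  change (g : Matrix (Fin 3) (Fin 3) ℂ) * (P * D) = P * D * Matrix.diagonal t
  rw [← mul_assoc, hPt, mul_assoc, mul_assoc]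
  simp [D, Matrix.diagonal_mul_diagonal, mul_comm]

/-- After diagonalization, logarithms of two eigenvalues determine a third one that makes the
trace zero. -/
theorem exists_exp_eq (g : SL3) (hg : IsOfFinOrder g) :
    ∃ X : sl3, (g : Matrix (Fin 3) (Fin 3) ℂ) = NormedSpace.exp (X : Matrix (Fin 3) (Fin 3) ℂ) := by
  obtain ⟨h, d, t, rfl, hd⟩ := exists_conj_diagonal g hg
  have ht : t 0 * t 1 * t 2 = 1 := by
    have := d.2
    rwa [hd, Matrix.det_diagonal, Fin.prod_univ_three] at this
  have h0 : t 0 ≠ 0 := fun h0 => by simp [h0] at ht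
  have h1 : t 1 ≠ 0 := fun h1 => by simp [h1] at ht
  let a : Fin 3 → ℂ := ![Complex.log (t 0), Complex.log (t 1),
    -(Complex.log (t 0) + Complex.log (t 1))]
  have ha : NormedSpace.exp a = t := by
    ext i
    rw [Pi.coe_exp, ← Complex.exp_eq_exp_ℂ]
    fin_cases i
    · exact Complex.exp_log h0
    · exact Complex.exp_log h1
    · change Complex.exp (-(Complex.log (t 0) + Complex.log (t 1))) = t 2
      rw [Complex.exp_neg, Complex.exp_add, Complex.exp_log h0, Complex.exp_log h1]
      exact inv_eq_of_mul_eq_one_right ht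
  have hu : IsUnit (h : Matrix (Fin 3) (Fin 3) ℂ) :=
    (Matrix.isUnit_iff_isUnit_det _).2 (by rw [h.2]; exact isUnit_one)
  have hinv : ((h⁻¹ : SL3) : Matrix (Fin 3) (Fin 3) ℂ) = (h : Matrix (Fin 3) (Fin 3) ℂ)⁻¹ := by
    rw [Matrix.SpecialLinearGroup.coe_inv, Matrix.inv_def, h.2]; simp
  refine ⟨⟨h * Matrix.diagonal a * (h : Matrix (Fin 3) (Fin 3) ℂ)⁻¹, ?_⟩, ?_⟩
  · change Matrix.trace (h.1 * Matrix.diagonal a * h.1⁻¹) = 0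
    rw [Matrix.trace_conj hu]
    simp [Matrix.trace, Fin.sum_univ_three, a]
  · rw [Matrix.exp_conj _ _ hu, Matrix.exp_diagonal, ha, ← hd, ← hinv]
    simp

end SL3

/-! ### Highest weight modules -/

/-- The grading of `sl₃` by the height of roots: the part of `X` on the `c`-th superdiagonal. -/
noncomputable def gradedPart (c : ℤ) : sl3 →ₗ[ℂ] sl3 where
  toFun X := ⟨Matrix.of fun i j => if (j : ℤ) - i = c then X.1 i j else 0, by
    obtain rfl | hc := eq_or_ne c 0
    · have h : Matrix.trace X.1 = 0 := X.2
      change Matrix.trace (_ : Matrix (Fin 3) (Fin 3) ℂ) = 0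
      simpa [Matrix.trace] using h
    · change Matrix.trace (_ : Matrix (Fin 3) (Fin 3) ℂ) = 0
      simp [Matrix.trace, hc.symm]⟩
  map_add' X Y := by
    ext i j
    change (if _ then X.1 i j + Y.1 i j else 0) =
      (if _ then X.1 i j else 0) + if _ then Y.1 i j else 0
    split_ifs <;> simp
  map_smul' a X := by
    ext i j
    change (if _ then a * X.1 i j else 0) = a * if _ then X.1 i j else 0
    split_ifs <;> simp

/-- `diag(1, 0, -1)`, on which both simple roots take the value `1`. -/
noncomputable def gradingElement : sl3 :=
  ⟨Matrix.diagonal ![1, 0, -1], by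
    change Matrix.trace (_ : Matrix (Fin 3) (Fin 3) ℂ) = 0
    simp [Matrix.trace, Fin.sum_univ_three]⟩

theorem gradingElement_lie_gradedPart (c : ℤ) (X : sl3) :
    ⁅gradingElement, gradedPart c X⁆ = (c : ℂ) • gradedPart c X := by
  apply Subtype.ext
  ext i j
  have h : (![1, 0, -1] : Fin 3 → ℂ) i - (![1, 0, -1] : Fin 3 → ℂ) j = ((j : ℤ) - i : ℤ) := by
    fin_cases i <;> fin_cases j <;> norm_num
  have hmul : (⁅gradingElement, gradedPart c X⁆ : sl3).1 i j =
      (![1, 0, -1] : Fin 3 → ℂ) i * (gradedPart c X).1 i j -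
        (gradedPart c X).1 i j * (![1, 0, -1] : Fin 3 → ℂ) j := by
    rw [LieAlgebra.SpecialLinear.sl_bracket, Matrix.sub_apply]
    exact congrArg₂ _ (Matrix.diagonal_mul _ _ _ _) (Matrix.mul_diagonal _ _ _ _)
  rw [hmul, mul_comm, ← mul_sub, h]
  change (if (j : ℤ) - i = c then X.1 i j else 0) * _ =
    c * (if (j : ℤ) - i = c then X.1 i j else 0)
  split_ifs with hc
  · rw [hc, mul_comm]
  · simp

/-- `X` vanishes on and below the diagonal. -/
def IsStrictUpper (X : sl3) : Prop := ∀ i j : Fin 3, j ≤ i → X.1 i j = 0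

/-- `X` vanishes above the diagonal. -/
def IsLower (X : sl3) : Prop := ∀ i j : Fin 3, i < j → X.1 i j = 0

theorem IsStrictUpper.eq_add {X : sl3} (hX : IsStrictUpper X) :
    X = gradedPart 1 X + gradedPart 2 X := by
  apply Subtype.ext
  ext i j
  change X.1 i j = (if (j : ℤ) - i = 1 then X.1 i j else 0) +
    (if (j : ℤ) - i = 2 then X.1 i j else 0)
  have h := hX i j
  fin_cases i <;> fin_cases j <;> simp_all

theorem IsLower.eq_add {X : sl3} (hX : IsLower X) :
    X = gradedPart 0 X + gradedPart (-1) X + gradedPart (-2) X := by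
  apply Subtype.ext
  ext i j
  change X.1 i j = (if (j : ℤ) - i = 0 then X.1 i j else 0) +
    (if (j : ℤ) - i = -1 then X.1 i j else 0) + (if (j : ℤ) - i = -2 then X.1 i j else 0)
  have h := hX i j
  fin_cases i <;> fin_cases j <;> simp_all

theorem exists_strictUpper_add_lower (X : sl3) :
    ∃ E Y : sl3, IsStrictUpper E ∧ IsLower Y ∧ X = E + Y := by
  refine ⟨gradedPart 1 X + gradedPart 2 X, X - (gradedPart 1 X + gradedPart 2 X),
    fun i j h => ?_, fun i j h => ?_, by simp⟩
  · change (if (j : ℤ) - i = 1 then X.1 i j else 0) + (if (j : ℤ) - i = 2 then X.1 i j else 0) = 0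
    rw [if_neg (by omega), if_neg (by omega), add_zero]
  · change X.1 i j - ((if (j : ℤ) - i = 1 then X.1 i j else 0) +
      (if (j : ℤ) - i = 2 then X.1 i j else 0)) = 0
    fin_cases i <;> fin_cases j <;> simp_all

section

variable {V : Type*} [AddCommGroup V] [Module ℂ V] [LieRingModule sl3 V]

/-- The smallest subspace containing `v` and stable under lower triangular matrices. -/
def lowerSpan (v : V) : Submodule ℂ V :=
  sInf {N | v ∈ N ∧ ∀ Y : sl3, IsLower Y → ∀ x ∈ N, ⁅Y, x⁆ ∈ N}

theorem mem_lowerSpan_self (v : V) : v ∈ lowerSpan v :=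
  Submodule.mem_sInf.2 fun _ hN => hN.1

theorem lie_mem_lowerSpan {v x : V} {Y : sl3} (hY : IsLower Y) (hx : x ∈ lowerSpan v) :
    ⁅Y, x⁆ ∈ lowerSpan v :=
  Submodule.mem_sInf.2 fun N hN => hN.2 Y hY x (Submodule.mem_sInf.1 hx N hN)

theorem lowerSpan_le {v : V} {N : Submodule ℂ V} (hv : v ∈ N)
    (hN : ∀ Y : sl3, IsLower Y → ∀ x ∈ N, ⁅Y, x⁆ ∈ N) : lowerSpan v ≤ N :=
  sInf_le ⟨hv, hN⟩

variable [LieModule ℂ sl3 V]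

open Module.End

/-- The action of `gradedPart c X` shifts the eigenvalues of `gradingElement` by `c`. -/
theorem gradedPart_lie_mem_eigenspace (c : ℤ) (X : sl3) {μ : ℂ} {v : V}
    (hv : v ∈ eigenspace (LieModule.toEnd ℂ sl3 V gradingElement) μ) :
    ⁅gradedPart c X, v⁆ ∈ eigenspace (LieModule.toEnd ℂ sl3 V gradingElement) (μ + c) := by
  rw [mem_eigenspace_iff, LieModule.toEnd_apply_apply] at hv ⊢
  rw [leibniz_lie, gradingElement_lie_gradedPart, smul_lie, hv, lie_smul, ← add_smul, add_comm]

/-- Any nonzero finite-dimensional module contains a nonzero vector killed by the strictly upper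
triangular matrices: an eigenvector of `gradingElement` whose eigenvalue has maximal real part. -/
theorem exists_ne_zero_strictUpper_lie_eq_zero [FiniteDimensional ℂ V] [Nontrivial V] :
    ∃ v : V, v ≠ 0 ∧ ∀ X : sl3, IsStrictUpper X → ⁅X, v⁆ = 0 := by
  let T : Module.End ℂ V := LieModule.toEnd ℂ sl3 V gradingElement
  have hfin : {μ | T.HasEigenvalue μ}.Finite := by
    simpa [Module.End.hasEigenvalue_iff_mem_spectrum] using T.finite_spectrum
  obtain ⟨μ, hμ, hmax⟩ := Set.exists_max_image _ Complex.re hfin (exists_eigenvalue T)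
  obtain ⟨v, hv⟩ := HasEigenvalue.exists_hasEigenvector hμ
  have key : ∀ (c : ℤ), 0 < c → ∀ X : sl3, ⁅gradedPart c X, v⁆ = 0 := fun c hc X => by
    by_contra h
    have := hmax _ (hasEigenvalue_of_hasEigenvector ⟨gradedPart_lie_mem_eigenspace c X hv.1, h⟩)
    have hc' : (0 : ℝ) < c := by exact_mod_cast hc
    simp at this
    linarith
  refine ⟨v, hv.2, fun X hX => ?_⟩
  rw [hX.eq_add, add_lie, key 1 (by norm_num), key 2 (by norm_num), add_zero]

/-- If `v` is killed by the strictly upper triangular matrices, then `lowerSpan v` is a submodule: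
the vectors `x` with `sl₃ x ⊆ lowerSpan v` contain `v` and are stable under lower triangular `Y`
because `X Y x = Y X x + [X, Y] x`. -/
def lowerSpanLie (v : V) (hv : ∀ X : sl3, IsStrictUpper X → ⁅X, v⁆ = 0) :
    LieSubmodule ℂ sl3 V where
  toSubmodule := lowerSpan v
  lie_mem := by
    let N : Submodule ℂ V :=
      { carrier := {x | x ∈ lowerSpan v ∧ ∀ X : sl3, ⁅X, x⁆ ∈ lowerSpan v}
        add_mem' := fun hx hy => ⟨add_mem hx.1 hy.1, fun X => by
          rw [lie_add]; exact add_mem (hx.2 X) (hy.2 X)⟩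
        zero_mem' := ⟨zero_mem _, fun X => by rw [lie_zero]; exact zero_mem _⟩
        smul_mem' := fun c x hx => ⟨Submodule.smul_mem _ c hx.1, fun X => by
          rw [lie_smul]; exact Submodule.smul_mem _ c (hx.2 X)⟩ }
    have h : lowerSpan v ≤ N := by
      refine lowerSpan_le ⟨mem_lowerSpan_self v, fun X => ?_⟩ fun Y hY x hx =>
        ⟨lie_mem_lowerSpan hY hx.1, fun X => ?_⟩
      · obtain ⟨E, Y, hE, hY, rfl⟩ := exists_strictUpper_add_lower X
        rw [add_lie, hv E hE, zero_add]
        exact lie_mem_lowerSpan hY (mem_lowerSpan_self v)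
      · rw [leibniz_lie]
        exact add_mem (hx.2 _) (lie_mem_lowerSpan hY (hx.2 X))
    intro X x hx
    exact (h hx).2 X

/-- All weights of `lowerSpan v` other than that of `v` lie below it. -/
theorem mem_span_of_mem_lowerSpan {v x : V} {μ : ℂ}
    (hv : ∀ X : sl3, ⁅gradedPart 0 X, v⁆ ∈ Submodule.span ℂ {v})
    (hμ : v ∈ eigenspace (LieModule.toEnd ℂ sl3 V gradingElement) μ)
    (hx : x ∈ lowerSpan v) (hxμ : x ∈ eigenspace (LieModule.toEnd ℂ sl3 V gradingElement) μ) :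
    x ∈ Submodule.span ℂ {v} := by
  let T : Module.End ℂ V := LieModule.toEnd ℂ sl3 V gradingElement
  let L : Submodule ℂ V := ⨆ k : ℕ, eigenspace T (μ - (k + 1))
  have hL : ∀ k : ℕ, eigenspace T (μ - (k + 1)) ≤ L :=
    le_iSup fun k : ℕ => eigenspace T (μ - (k + 1))
  have hsub : ∀ (c : ℕ) (X : sl3), ∀ y ∈ L, ⁅gradedPart (-c) X, y⁆ ∈ L := fun c X y hy => by
    induction hy using Submodule.iSup_induction' with
    | mem k y hy =>
      refine hL (k + c) ?_
      convert gradedPart_lie_mem_eigenspace (-c : ℤ) X hy using 1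
      push_cast; ring_nf; rfl
    | zero => rw [lie_zero]; exact zero_mem _
    | add y z _ _ hy hz => rw [lie_add]; exact add_mem hy hz
  have hvL : ∀ (c : ℕ) (X : sl3), ⁅gradedPart (-(c + 1 : ℕ)) X, v⁆ ∈ L := fun c X => by
    refine hL c ?_
    convert gradedPart_lie_mem_eigenspace (-(c + 1 : ℕ) : ℤ) X hμ using 1
    push_cast; ring_nf; rfl
  have hle : lowerSpan v ≤ Submodule.span ℂ {v} ⊔ L := by
    refine lowerSpan_le (Submodule.mem_sup_left (Submodule.mem_span_singleton_self v)) ?_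
    intro Y hY y hy
    obtain ⟨a, ha, b, hb, rfl⟩ := Submodule.mem_sup.1 hy
    obtain ⟨r, rfl⟩ := Submodule.mem_span_singleton.1 ha
    rw [hY.eq_add, lie_add, lie_smul]
    refine add_mem (Submodule.smul_mem _ _ ?_) (Submodule.mem_sup_right ?_)
    · rw [add_lie, add_lie]
      exact add_mem (add_mem (Submodule.mem_sup_left (hv Y)) (Submodule.mem_sup_right (hvL 0 Y)))
        (Submodule.mem_sup_right (hvL 1 Y))
    · rw [add_lie, add_lie]
      exact add_mem (add_mem (hsub 0 Y b hb) (hsub 1 Y b hb)) (hsub 2 Y b hb)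
  obtain ⟨a, ha, b, hb, rfl⟩ := Submodule.mem_sup.1 (hle hx)
  have hb' : b ∈ eigenspace T μ := by
    have : a ∈ eigenspace T μ := (Submodule.span_singleton_le_iff_mem _ _).2 hμ ha
    have h := sub_mem hxμ this
    rwa [add_sub_cancel_left] at h
  have hLle : L ≤ ⨆ ν, ⨆ _ : ν ≠ μ, eigenspace T ν := iSup_le fun k =>
    le_iSup₂_of_le (μ - (k + 1)) (fun h => by
      have h' : (k : ℂ) + 1 = 0 := by linear_combination -h
      exact Nat.cast_add_one_ne_zero k h') le_rfl
  have := (disjoint_iff_inf_le.1 (eigenspaces_iSupIndep T μ)) ⟨hb', hLle hb⟩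
  rw [(Submodule.mem_bot ℂ).1 this, add_zero]
  exact ha

end

section Prod

variable {L M N : Type*} [LieRing L] [AddCommGroup M] [AddCommGroup N] [LieRingModule L M]
  [LieRingModule L N]

instance Prod.instLieRingModule : LieRingModule L (M × N) where
  bracket X p := (⁅X, p.1⁆, ⁅X, p.2⁆)
  add_lie X Y p := by ext <;> simp
  lie_add X p q := by ext <;> simp
  leibniz_lie X Y p := by ext <;> simp

theorem Prod.lie_mk (X : L) (p : M × N) : ⁅X, p⁆ = (⁅X, p.1⁆, ⁅X, p.2⁆) := rfl

instance Prod.instLieModule {R : Type*} [CommRing R] [LieAlgebra R L] [Module R M] [Module R N]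
    [LieModule R L M] [LieModule R L N] : LieModule R L (M × N) where
  smul_lie a X p := by ext <;> simp [Prod.lie_mk]
  lie_smul a X p := by ext <;> simp [Prod.lie_mk]

end Prod

/-- A simple module is determined by its highest weight: the submodule of `V × W` generated by the
pair of highest weight vectors is the graph of an isomorphism. -/
theorem exists_linearEquiv_of_hasHighestWeight {V W : Type*} [AddCommGroup V] [Module ℂ V]
    [LieRingModule sl3 V] [LieModule ℂ sl3 V] [AddCommGroup W] [Module ℂ W]
    [LieRingModule sl3 W] [LieModule ℂ sl3 W] (hV : LieModule.IsIrreducible ℂ sl3 V)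
    (hW : LieModule.IsIrreducible ℂ sl3 W) {m n : ℕ} (hVmn : HasHighestWeight V m n)
    (hWmn : HasHighestWeight W m n) :
    ∃ e : V ≃ₗ[ℂ] W, ∀ (X : sl3) (x : V), e ⁅X, x⁆ = ⁅X, e x⁆ := by
  obtain ⟨v, hv0, hv, hvH⟩ := hVmn
  obtain ⟨w, hw0, hw, hwH⟩ := hWmn
  have hvw : ∀ X : sl3, IsStrictUpper X → ⁅X, (v, w)⁆ = 0 := fun X hX => by
    rw [Prod.lie_mk]; exact Prod.ext (hv X hX) (hw X hX)
  let N : LieSubmodule ℂ sl3 (V × W) := lowerSpanLie (v, w) hvw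
  have hvwN : (v, w) ∈ N := mem_lowerSpan_self _
  have hdiag : ∀ X i j, i ≠ j → (gradedPart 0 X).1 i j = 0 := fun X i j h => by
    change (if (j : ℤ) - i = 0 then X.1 i j else 0) = 0
    rw [if_neg]; omega
  have hgr : ∀ i j, i ≠ j → gradingElement.1 i j = 0 := fun i j h => Matrix.diagonal_apply_ne _ h
  have hspan : ∀ (a b : ℂ), (a • v, b • w) ∈ N → a = b := fun a b h => by
    have := mem_span_of_mem_lowerSpan (v := (v, w)) (x := (a • v, b • w))
      (μ := (m : ℂ) * gradingElement.1 0 0 + n * (gradingElement.1 0 0 + gradingElement.1 1 1))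
      (fun X => Submodule.mem_span_singleton.2
        ⟨_, (Prod.ext (hvH _ (hdiag X)) (hwH _ (hdiag X))).symm⟩)
      (Module.End.mem_eigenspace_iff.2 (Prod.ext (hvH _ hgr) (hwH _ hgr))) h
      (Module.End.mem_eigenspace_iff.2 (Prod.ext
        (by simp [Prod.lie_mk, hvH _ hgr, smul_comm a])
        (by simp [Prod.lie_mk, hwH _ hgr, smul_comm b])))
    obtain ⟨c, hc⟩ := Submodule.mem_span_singleton.1 this
    have h₁ := smul_left_injective ℂ hv0 (congrArg Prod.fst hc)
    have h₂ := smul_left_injective ℂ hw0 (congrArg Prod.snd hc)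
    exact h₁.symm.trans h₂
  -- The kernels of the two projections are proper submodules.
  have hfst : ∀ y : W, (0, y) ∈ N → y = 0 := fun y hy => by
    let K : LieSubmodule ℂ sl3 W :=
      { (N.toSubmodule.comap (LinearMap.inr ℂ V W)) with
        lie_mem := fun {X y} hy => by
          have h := N.lie_mem (x := X) (m := (0, y)) hy
          rw [Prod.lie_mk, lie_zero] at h
          exact h }
    have hK : K = ⊥ := (IsSimpleOrder.eq_bot_or_eq_top K).resolve_right fun h => by
      have hw' : (0, w) ∈ N := (h ▸ LieSubmodule.mem_top w : w ∈ K)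
      have := hspan 0 1 (by simpa using hw')
      exact zero_ne_one this
    exact (LieSubmodule.mem_bot (R := ℂ) (L := sl3) y).1 (hK ▸ (show y ∈ K from hy))
  have hsnd : ∀ x : V, (x, 0) ∈ N → x = 0 := fun x hx => by
    let K : LieSubmodule ℂ sl3 V :=
      { (N.toSubmodule.comap (LinearMap.inl ℂ V W)) with
        lie_mem := fun {X y} hy => by
          have h := N.lie_mem (x := X) (m := (y, 0)) hy
          rw [Prod.lie_mk, lie_zero] at h
          exact h }
    have hK : K = ⊥ := (IsSimpleOrder.eq_bot_or_eq_top K).resolve_right fun h => by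
      have hv' : (v, 0) ∈ N := (h ▸ LieSubmodule.mem_top v : v ∈ K)
      have := hspan 1 0 (by simpa using hv')
      exact one_ne_zero this
    exact (LieSubmodule.mem_bot (R := ℂ) (L := sl3) x).1 (hK ▸ (show x ∈ K from hx))
  -- The images of the two projections are nonzero submodules.
  have hfst' : ∀ x : V, ∃ y : W, (x, y) ∈ N := fun x => by
    let K : LieSubmodule ℂ sl3 V :=
      { (N.toSubmodule.map (LinearMap.fst ℂ V W)) with
        lie_mem := fun {X y} hy => by
          obtain ⟨z, hz, rfl⟩ := hy
          exact ⟨⁅X, z⁆, N.lie_mem hz, rfl⟩ }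
    have hK : K = ⊤ := (IsSimpleOrder.eq_bot_or_eq_top K).resolve_left fun h => hv0 <| by
      have : v ∈ K := ⟨(v, w), hvwN, rfl⟩
      rw [h] at this
      exact (LieSubmodule.mem_bot (R := ℂ) (L := sl3) v).1 this
    obtain ⟨z, hz, rfl⟩ : x ∈ K := hK ▸ LieSubmodule.mem_top x
    exact ⟨z.2, hz⟩
  have hsnd' : ∀ y : W, ∃ x : V, (x, y) ∈ N := fun y => by
    let K : LieSubmodule ℂ sl3 W :=
      { (N.toSubmodule.map (LinearMap.snd ℂ V W)) with
        lie_mem := fun {X y} hy => by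
          obtain ⟨z, hz, rfl⟩ := hy
          exact ⟨⁅X, z⁆, N.lie_mem hz, rfl⟩ }
    have hK : K = ⊤ := (IsSimpleOrder.eq_bot_or_eq_top K).resolve_left fun h => hw0 <| by
      have : w ∈ K := ⟨(v, w), hvwN, rfl⟩
      rw [h] at this
      exact (LieSubmodule.mem_bot (R := ℂ) (L := sl3) w).1 this
    obtain ⟨z, hz, rfl⟩ : y ∈ K := hK ▸ LieSubmodule.mem_top y
    exact ⟨z.1, hz⟩
  let p : N →ₗ[ℂ] V := LinearMap.fst ℂ V W ∘ₗ N.toSubmodule.subtype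
  let q : N →ₗ[ℂ] W := LinearMap.snd ℂ V W ∘ₗ N.toSubmodule.subtype
  let P : N ≃ₗ[ℂ] V := LinearEquiv.ofBijective p
    ⟨(injective_iff_map_eq_zero p).2 fun z (hz : z.1.1 = 0) => by
      have h : (0, z.1.2) ∈ N := by rw [← hz]; exact z.2
      exact Subtype.ext (Prod.ext hz (hfst _ h)),
    fun x => (hfst' x).elim fun y hy => ⟨⟨(x, y), hy⟩, rfl⟩⟩
  let Q : N ≃ₗ[ℂ] W := LinearEquiv.ofBijective q
    ⟨(injective_iff_map_eq_zero q).2 fun z (hz : z.1.2 = 0) => by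
      have h : (z.1.1, 0) ∈ N := by rw [← hz]; exact z.2
      exact Subtype.ext (Prod.ext (hsnd _ h) hz),
    fun y => (hsnd' y).elim fun x hx => ⟨⟨(x, y), hx⟩, rfl⟩⟩
  refine ⟨P.symm.trans Q, fun X x => ?_⟩
  obtain ⟨z, rfl⟩ := P.surjective x
  have : ⁅X, P z⁆ = P ⁅X, z⁆ := rfl
  rw [this, LinearEquiv.trans_apply, LinearEquiv.trans_apply, P.symm_apply_apply,
    P.symm_apply_apply]
  rfl

/-! ### The polynomial model -/

open MvPolynomial

/-- Polynomials in the coordinates `x_i = X (inl i)` of `ℂ³` and the dual coordinates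
`y_i = X (inr i)`. -/
abbrev BiPoly : Type := MvPolynomial (Fin 3 ⊕ Fin 3) ℂ

theorem Derivation.finsetSum_apply {R A M ι : Type*} [CommSemiring R] [CommSemiring A]
    [Algebra R A] [AddCommMonoid M] [Module A M] [Module R M] (s : Finset ι)
    (D : ι → Derivation R A M) (a : A) : (∑ i ∈ s, D i) a = ∑ i ∈ s, D i a := by
  induction s using Finset.cons_induction with
  | empty => simp
  | cons i s hi ih => rw [Finset.sum_cons, Finset.sum_cons, Derivation.add_apply, ih]

namespace BiPoly

/-- The operator `x_i ∂/∂x_j - y_j ∂/∂y_i` by which the elementary matrix `e_{ij}` acts. -/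
noncomputable def elemDer (i j : Fin 3) : Derivation ℂ BiPoly BiPoly :=
  (X (Sum.inl i) : BiPoly) • pderiv (Sum.inl j) - (X (Sum.inr j) : BiPoly) • pderiv (Sum.inr i)

/-- The action of a matrix by derivations: the natural action on the span of the `x_i`, and the
dual one on the span of the `y_i`. -/
noncomputable def glDer : Matrix (Fin 3) (Fin 3) ℂ →ₗ[ℂ] Derivation ℂ BiPoly BiPoly where
  toFun A := ∑ i, ∑ j, A i j • elemDer i j
  map_add' A B := by simp [add_smul, Finset.sum_add_distrib]
  map_smul' c A := by simp [Finset.smul_sum, mul_smul]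

theorem elemDer_apply (i j : Fin 3) (f : BiPoly) : elemDer i j f =
    X (Sum.inl i) * pderiv (Sum.inl j) f - X (Sum.inr j) * pderiv (Sum.inr i) f := rfl

theorem glDer_apply (A : Matrix (Fin 3) (Fin 3) ℂ) (f : BiPoly) :
    glDer A f = ∑ i, ∑ j, A i j • elemDer i j f := by
  simp [glDer, Derivation.finsetSum_apply]

theorem glDer_single (i j : Fin 3) : glDer (Matrix.single i j 1) = elemDer i j := by
  ext1 f
  simp [glDer, Matrix.single_apply, ite_and]

theorem glDer_X_inl (A : Matrix (Fin 3) (Fin 3) ℂ) (k : Fin 3) :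
    glDer A (X (Sum.inl k)) = ∑ i, A i k • X (Sum.inl i) := by
  simp [glDer_apply, elemDer_apply, pderiv_X, Pi.single_apply]

theorem glDer_X_inr (A : Matrix (Fin 3) (Fin 3) ℂ) (k : Fin 3) :
    glDer A (X (Sum.inr k)) = -∑ j, A k j • X (Sum.inr j) := by
  rw [glDer_apply, Finset.sum_comm]
  simp [elemDer_apply, pderiv_X, Pi.single_apply]

theorem glDer_lie (A B : Matrix (Fin 3) (Fin 3) ℂ) : glDer ⁅A, B⁆ = ⁅glDer A, glDer B⁆ := by
  refine MvPolynomial.derivation_ext fun s => ?_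
  rw [Derivation.commutator_apply]
  rcases s with k | k
  · simp only [glDer_X_inl, map_sum, Derivation.map_smul, Ring.lie_def, Matrix.sub_apply,
      Matrix.mul_apply, sub_smul, Finset.sum_smul, Finset.sum_sub_distrib, Finset.smul_sum,
      smul_smul]
    congr 1 <;> rw [Finset.sum_comm] <;> simp only [mul_comm]
  · simp only [glDer_X_inr, map_sum, map_neg, Derivation.map_smul, Ring.lie_def,
      Matrix.sub_apply, Matrix.mul_apply, sub_smul, Finset.sum_smul, Finset.sum_sub_distrib,
      Finset.smul_sum, smul_smul, smul_neg, Finset.sum_neg_distrib, neg_neg, neg_sub]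
    congr 1 <;> rw [Finset.sum_comm]

/-- The derivation multiplying the variable `s` by `c s`; it is diagonal on monomials. -/
noncomputable def euler (c : Fin 3 ⊕ Fin 3 → ℂ) : Derivation ℂ BiPoly BiPoly :=
  ∑ s, c s • ((X s : BiPoly) • pderiv s)

theorem euler_monomial (c : Fin 3 ⊕ Fin 3 → ℂ) (d : Fin 3 ⊕ Fin 3 →₀ ℕ) (a : ℂ) :
    euler c (monomial d a) = (∑ s, c s * d s) • monomial d a := by
  rw [euler, Derivation.finsetSum_apply, Finset.sum_smul]
  refine Finset.sum_congr rfl fun s _ => ?_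
  rw [Derivation.smul_apply, Derivation.smul_apply, smul_eq_mul, X_mul_pderiv_monomial, mul_smul,
    Nat.cast_smul_eq_nsmul]

theorem euler_X (c : Fin 3 ⊕ Fin 3 → ℂ) (s : Fin 3 ⊕ Fin 3) : euler c (X s) = c s • X s := by
  rw [X, euler_monomial, Finset.sum_eq_single s (fun t _ h => by simp [h.symm]) (by simp)]
  simp

theorem coeff_euler (c : Fin 3 ⊕ Fin 3 → ℂ) (f : BiPoly) (d : Fin 3 ⊕ Fin 3 →₀ ℕ) :
    coeff d (euler c f) = (∑ s, c s * d s) * coeff d f := by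
  classical
  induction f using MvPolynomial.induction_on' with
  | monomial e a =>
    rw [euler_monomial, coeff_smul, coeff_monomial, smul_eq_mul]
    split_ifs with h
    · rw [h]
    · simp
  | add f g hf hg => rw [map_add, coeff_add, hf, hg, coeff_add, mul_add]

theorem elemDer_self (i : Fin 3) :
    elemDer i i = euler (Pi.single (Sum.inl i) 1 - Pi.single (Sum.inr i) 1) := by
  refine MvPolynomial.derivation_ext fun s => ?_
  rcases s with k | k <;> simp [elemDer_apply, euler_X, pderiv_X, Pi.single_apply] <;> aesop

/-- The degree in the `x_i`, as an operator. -/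
noncomputable def degX : Derivation ℂ BiPoly BiPoly := euler (Sum.elim 1 0)

/-- The degree in the `y_i`, as an operator. -/
noncomputable def degY : Derivation ℂ BiPoly BiPoly := euler (Sum.elim 0 1)

theorem degX_apply (f : BiPoly) :
    degX f = ∑ i, X (Sum.inl i) * pderiv (Sum.inl i) f := by
  have : degX = ∑ i, (X (Sum.inl i) : BiPoly) • pderiv (Sum.inl i) := by
    refine MvPolynomial.derivation_ext fun s => ?_
    rcases s with k | k <;>
    simp [degX, euler_X, pderiv_X, Pi.single_apply, Derivation.finsetSum_apply]
  rw [this]; simp [Derivation.finsetSum_apply]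

theorem degY_apply (f : BiPoly) :
    degY f = ∑ i, X (Sum.inr i) * pderiv (Sum.inr i) f := by
  have : degY = ∑ i, (X (Sum.inr i) : BiPoly) • pderiv (Sum.inr i) := by
    refine MvPolynomial.derivation_ext fun s => ?_
    rcases s with k | k <;>
    simp [degY, euler_X, pderiv_X, Pi.single_apply, Derivation.finsetSum_apply]
  rw [this]; simp [Derivation.finsetSum_apply]

theorem degX_glDer (A : Matrix (Fin 3) (Fin 3) ℂ) (f : BiPoly) :
    degX (glDer A f) = glDer A (degX f) := by
  have : ⁅degX, glDer A⁆ = 0 := by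
    refine MvPolynomial.derivation_ext fun s => ?_
    rw [Derivation.commutator_apply]
    rcases s with k | k <;> simp [degX, euler_X, glDer_X_inl, glDer_X_inr, Derivation.map_smul]
  rw [← sub_eq_zero, ← Derivation.commutator_apply, this, Derivation.zero_apply]

theorem degY_glDer (A : Matrix (Fin 3) (Fin 3) ℂ) (f : BiPoly) :
    degY (glDer A f) = glDer A (degY f) := by
  have : ⁅degY, glDer A⁆ = 0 := by
    refine MvPolynomial.derivation_ext fun s => ?_
    rw [Derivation.commutator_apply]
    rcases s with k | k <;> simp [degY, euler_X, glDer_X_inl, glDer_X_inr, Derivation.map_smul]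
  rw [← sub_eq_zero, ← Derivation.commutator_apply, this, Derivation.zero_apply]

/-- The contraction `∑ ∂²/∂x_i∂y_i`. -/
noncomputable def laplacian : BiPoly →ₗ[ℂ] BiPoly :=
  ∑ i, (pderiv (Sum.inl i)).toLinearMap ∘ₗ (pderiv (Sum.inr i)).toLinearMap

theorem laplacian_apply (f : BiPoly) :
    laplacian f = ∑ i, pderiv (Sum.inl i) (pderiv (Sum.inr i) f) := by
  simp [laplacian]

theorem pderiv_inl_glDer (A : Matrix (Fin 3) (Fin 3) ℂ) (k : Fin 3) (f : BiPoly) :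
    pderiv (Sum.inl k) (glDer A f) =
      glDer A (pderiv (Sum.inl k) f) + ∑ j, A k j • pderiv (Sum.inl j) f := by
  have : ⁅(pderiv (Sum.inl k) : Derivation ℂ BiPoly BiPoly), glDer A⁆ =
      ∑ j, A k j • pderiv (R := ℂ) (Sum.inl j : Fin 3 ⊕ Fin 3) := by
    refine MvPolynomial.derivation_ext fun s => ?_
    rw [Derivation.commutator_apply]
    rcases s with l | l <;>
    simp [glDer_X_inl, glDer_X_inr, pderiv_X, Pi.single_apply, Derivation.finsetSum_apply,
      Derivation.map_smul, apply_ite (glDer A)]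
  have h := congrArg (fun D => D f) this
  simp only [Derivation.commutator_apply, Derivation.finsetSum_apply, Derivation.smul_apply] at h
  rw [← h]; ring

theorem pderiv_inr_glDer (A : Matrix (Fin 3) (Fin 3) ℂ) (k : Fin 3) (f : BiPoly) :
    pderiv (Sum.inr k) (glDer A f) =
      glDer A (pderiv (Sum.inr k) f) - ∑ j, A j k • pderiv (Sum.inr j) f := by
  have : ⁅(pderiv (Sum.inr k) : Derivation ℂ BiPoly BiPoly), glDer A⁆ =
      -∑ j, A j k • pderiv (R := ℂ) (Sum.inr j : Fin 3 ⊕ Fin 3) := by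
    refine MvPolynomial.derivation_ext fun s => ?_
    rw [Derivation.commutator_apply]
    rcases s with l | l <;>
    simp [glDer_X_inl, glDer_X_inr, pderiv_X, Pi.single_apply, Derivation.finsetSum_apply,
      Derivation.map_smul, apply_ite (glDer A)]
  have h := congrArg (fun D => D f) this
  simp only [Derivation.commutator_apply, Derivation.finsetSum_apply, Derivation.smul_apply,
    Derivation.neg_apply] at h
  rw [sub_eq_add_neg, ← h]; ring

theorem laplacian_glDer (A : Matrix (Fin 3) (Fin 3) ℂ) (f : BiPoly) :
    laplacian (glDer A f) = glDer A (laplacian f) := by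
  simp only [laplacian_apply, pderiv_inr_glDer, map_sub, pderiv_inl_glDer, map_sum,
    Derivation.map_smul]
  rw [Finset.sum_sub_distrib, Finset.sum_add_distrib, Finset.sum_comm (f := fun k j => _ • _),
    add_sub_cancel_right]

theorem pderiv_pderiv_comm (s t : Fin 3 ⊕ Fin 3) (f : BiPoly) :
    pderiv (R := ℂ) s (pderiv t f) = pderiv t (pderiv s f) := by
  classical
  have : ⁅(pderiv s : Derivation ℂ BiPoly BiPoly),
      (pderiv t : Derivation ℂ BiPoly BiPoly)⁆ = 0 := by
    refine MvPolynomial.derivation_ext fun r => ?_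
    rw [Derivation.commutator_apply, pderiv_X, pderiv_X]
    simp [Pi.single_apply, apply_ite (pderiv (R := ℂ) _)]
  rw [← sub_eq_zero, ← Derivation.commutator_apply, this, Derivation.zero_apply]

/-- Two expressions for the quadratic Casimir operator of `gl₃`: its diagonal part plus terms that
start with a raising operator, and a polynomial in the degree operators up to a multiple of the
contraction. -/
theorem casimir (f : BiPoly) :
    (∑ i, elemDer i i (elemDer i i f)) + 2 * elemDer 0 0 f - 2 * elemDer 2 2 f -
      (degX (degX f) + 2 * degX f + degY (degY f) + 2 * degY f) =
    -2 * (elemDer 1 0 (elemDer 0 1 f) + elemDer 2 0 (elemDer 0 2 f) + elemDer 2 1 (elemDer 1 2 f)) -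
      2 * (∑ i, X (Sum.inl i) * X (Sum.inr i)) * laplacian f := by
  have hcomm := fun s t => pderiv_pderiv_comm s t f
  simp only [degX_apply, degY_apply, elemDer_apply, laplacian_apply, Fin.sum_univ_three, map_add,
    map_sub, pderiv_mul, pderiv_X, Pi.single_apply]
  simp only [reduceCtorEq, if_false, Sum.inl.injEq, Sum.inr.injEq, Fin.reduceEq, if_true,
    hcomm (Sum.inr _) (Sum.inl _), hcomm (Sum.inl 1) (Sum.inl 0), hcomm (Sum.inl 2) (Sum.inl 0),
    hcomm (Sum.inl 2) (Sum.inl 1), hcomm (Sum.inr 1) (Sum.inr 0), hcomm (Sum.inr 2) (Sum.inr 0),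
    hcomm (Sum.inr 2) (Sum.inr 1)]
  ring

end BiPoly

/-! ### Harmonic polynomials and their irreducibility -/

namespace BiPoly

/-- The exponents of the monomials of degree `m` in the `x_i` and `n` in the `y_i`. -/
def biExp (m n : ℕ) : Set (Fin 3 ⊕ Fin 3 →₀ ℕ) :=
  {d | ∑ i, d (Sum.inl i) = m ∧ ∑ i, d (Sum.inr i) = n}

theorem finite_biExp (m n : ℕ) : (biExp m n).Finite := by
  refine (Set.finite_Iic (Finsupp.equivFunOnFinite.symm fun _ => m + n)).subset ?_
  rintro d ⟨h₁, h₂⟩ (s | s)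
  · exact (Finset.single_le_sum (fun i _ => Nat.zero_le (d (Sum.inl i))) (Finset.mem_univ s)).trans
      (h₁.le.trans (Nat.le_add_right m n))
  · exact (Finset.single_le_sum (fun i _ => Nat.zero_le (d (Sum.inr i))) (Finset.mem_univ s)).trans
      (h₂.le.trans (Nat.le_add_left n m))

/-- The polynomials of degree `m` in the `x_i` and `n` in the `y_i`. -/
noncomputable def biHom (m n : ℕ) : Submodule ℂ BiPoly := restrictSupport ℂ (biExp m n)

instance (m n : ℕ) : FiniteDimensional ℂ (biHom m n) := by
  have := (finite_biExp m n).to_subtype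
  exact (basisRestrictSupport ℂ (biExp m n)).finiteDimensional_of_finite

theorem mem_biHom {m n : ℕ} {f : BiPoly} :
    f ∈ biHom m n ↔ ∀ d, coeff d f ≠ 0 → d ∈ biExp m n := by
  rw [biHom, mem_restrictSupport_iff]
  simp [Set.subset_def]

theorem monomial_mem_biHom {m n : ℕ} {e : Fin 3 ⊕ Fin 3 →₀ ℕ} (he : e ∈ biExp m n) :
    monomial e 1 ∈ biHom m n := mem_biHom.2 fun d hd => by
  rw [coeff_monomial] at hd
  obtain rfl : e = d := by by_contra h; simp [h] at hd
  exact he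

theorem mem_biHom_iff_deg {m n : ℕ} {f : BiPoly} :
    f ∈ biHom m n ↔ degX f = (m : ℂ) • f ∧ degY f = (n : ℂ) • f := by
  have hX : ∀ d, coeff d (degX f) = ((∑ i, d (Sum.inl i) : ℕ) : ℂ) * coeff d f := fun d => by
    rw [degX, coeff_euler]; simp
  have hY : ∀ d, coeff d (degY f) = ((∑ i, d (Sum.inr i) : ℕ) : ℂ) * coeff d f := fun d => by
    rw [degY, coeff_euler]; simp
  rw [mem_biHom, MvPolynomial.ext_iff, MvPolynomial.ext_iff, ← forall_and]
  refine forall_congr' fun d => ?_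
  rw [hX, hY, coeff_smul, coeff_smul, smul_eq_mul, smul_eq_mul]
  obtain h | h := eq_or_ne (coeff d f) 0
  · simp [h]
  · rw [mul_left_inj' h, mul_left_inj' h, Nat.cast_inj, Nat.cast_inj]
    simp [h, biExp]

theorem glDer_mem_biHom {m n : ℕ} {f : BiPoly} (A : Matrix (Fin 3) (Fin 3) ℂ)
    (hf : f ∈ biHom m n) : glDer A f ∈ biHom m n := by
  rw [mem_biHom_iff_deg] at hf ⊢
  rw [degX_glDer, degY_glDer, hf.1, hf.2, Derivation.map_smul, Derivation.map_smul]
  exact ⟨rfl, rfl⟩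

/-- The harmonic bihomogeneous polynomials: the model of the simple module of highest weight
`m ϖ₁ + n ϖ₂`. -/
noncomputable def harm (m n : ℕ) : Submodule ℂ BiPoly := biHom m n ⊓ LinearMap.ker laplacian

theorem glDer_mem_harm {m n : ℕ} {f : BiPoly} (A : Matrix (Fin 3) (Fin 3) ℂ)
    (hf : f ∈ harm m n) : glDer A f ∈ harm m n :=
  Submodule.mem_inf.2 ⟨glDer_mem_biHom A hf.1, LinearMap.mem_ker.2 <| by
    rw [laplacian_glDer, LinearMap.mem_ker.1 hf.2, map_zero]⟩

instance (m n : ℕ) : FiniteDimensional ℂ (harm m n) :=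
  Submodule.finiteDimensional_inf_left _ _

noncomputable instance (m n : ℕ) : LieRingModule sl3 (harm m n) where
  bracket A f := ⟨glDer A.1 f.1, glDer_mem_harm A.1 f.2⟩
  add_lie A B f := Subtype.ext (by
    change glDer (A.1 + B.1) f.1 = _
    rw [map_add]; rfl)
  lie_add A f g := Subtype.ext (map_add (glDer A.1) f.1 g.1)
  leibniz_lie A B f := Subtype.ext (by
    change glDer A.1 (glDer B.1 f.1) = glDer ⁅A.1, B.1⁆ f.1 + glDer B.1 (glDer A.1 f.1)
    rw [glDer_lie, Derivation.commutator_apply, sub_add_cancel])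

theorem coe_lie {m n : ℕ} (A : sl3) (f : harm m n) : (⁅A, f⁆ : harm m n).1 = glDer A.1 f.1 := rfl

instance (m n : ℕ) : LieModule ℂ sl3 (harm m n) where
  smul_lie c A f := Subtype.ext (by
    change glDer (c • A.1) f.1 = c • glDer A.1 f.1
    rw [map_smul]; rfl)
  lie_smul c A f := Subtype.ext ((glDer A.1).map_smul c f.1)

/-- The exponent of the highest weight vector `x₀ᵐ y₂ⁿ`. -/
noncomputable def topExp (m n : ℕ) : Fin 3 ⊕ Fin 3 →₀ ℕ :=
  Finsupp.single (Sum.inl 0) m + Finsupp.single (Sum.inr 2) n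

theorem elemDer_topExp_of_lt (m n : ℕ) {i j : Fin 3} (h : i < j) :
    elemDer i j (monomial (topExp m n) 1) = 0 := by
  have hj : (Sum.inl j : Fin 3 ⊕ Fin 3) ≠ Sum.inl 0 := fun e => by
    have := Sum.inl.inj e; subst this; exact absurd h (by simp)
  have hi : (Sum.inr i : Fin 3 ⊕ Fin 3) ≠ Sum.inr 2 := fun e => by
    have := Sum.inr.inj e; subst this; exact absurd h (by omega)
  rw [elemDer_apply, pderiv_monomial, pderiv_monomial]
  simp [topExp, hj.symm, hi.symm]

theorem elemDer_self_topExp (m n : ℕ) (i : Fin 3) :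
    elemDer i i (monomial (topExp m n) 1) =
      ((if i = 0 then (m : ℂ) else 0) - if i = 2 then (n : ℂ) else 0) •
        monomial (topExp m n) 1 := by
  rw [elemDer_self, euler_monomial]
  congr 1
  fin_cases i <;> simp [topExp, Finsupp.single_apply, Pi.single_apply]

theorem monomial_topExp_mem_harm (m n : ℕ) : monomial (topExp m n) (1 : ℂ) ∈ harm m n := by
  refine Submodule.mem_inf.2 ⟨monomial_mem_biHom ?_, LinearMap.mem_ker.2 ?_⟩
  · simp [biExp, topExp, Fin.sum_univ_three]
  · rw [laplacian_apply]
    refine Finset.sum_eq_zero fun i _ => ?_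
    rw [pderiv_monomial, pderiv_monomial]
    have : (topExp m n) (Sum.inl i) = 0 ∨ (topExp m n) (Sum.inr i) = 0 := by
      fin_cases i <;> simp [topExp]
    rcases this with h | h <;> simp [h]

theorem harm_hasHighestWeight (m n : ℕ) : HasHighestWeight (harm m n) m n := by
  refine ⟨⟨_, monomial_topExp_mem_harm m n⟩, fun h => ?_, fun A hA => Subtype.ext ?_,
    fun A hA => Subtype.ext ?_⟩
  · have := congrArg (fun f : harm m n => coeff (topExp m n) f.1) h
    simp at this
  · rw [coe_lie, glDer_apply]
    refine Finset.sum_eq_zero fun i _ => Finset.sum_eq_zero fun j _ => ?_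
    obtain h | h := lt_or_ge i j
    · rw [elemDer_topExp_of_lt m n h, smul_zero]
    · rw [hA i j h, zero_smul]
  · have htr : A.1 0 0 + A.1 1 1 + A.1 2 2 = 0 := by
      have : Matrix.trace A.1 = 0 := A.2
      simpa [Matrix.trace, Fin.sum_univ_three] using this
    have hsum : ∀ i, ∑ j, A.1 i j • elemDer i j (monomial (topExp m n) 1) =
        A.1 i i • elemDer i i (monomial (topExp m n) 1) := fun i =>
      Finset.sum_eq_single i (fun j _ h => by rw [hA i j h.symm, zero_smul]) (by simp)
    rw [coe_lie, glDer_apply]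
    simp only [hsum, elemDer_self_topExp, smul_smul, ← Finset.sum_smul, Fin.sum_univ_three]
    change _ = _ • monomial (topExp m n) (1 : ℂ)
    congr 1
    simp
    linear_combination (-n : ℂ) * htr

/-- The quadratic Casimir operator modulo the part that vanishes on highest weight vectors, minus
its value on `x₀ᵐ y₂ⁿ`. It is diagonal on monomials. -/
noncomputable def shiftedCasimir (m n : ℕ) : BiPoly →ₗ[ℂ] BiPoly :=
  (∑ i, (elemDer i i).toLinearMap ∘ₗ (elemDer i i).toLinearMap) +
    (2 : ℂ) • (elemDer 0 0).toLinearMap - (2 : ℂ) • (elemDer 2 2).toLinearMap -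
    ((m : ℂ) ^ 2 + 2 * m + n ^ 2 + 2 * n) • LinearMap.id

theorem shiftedCasimir_apply (m n : ℕ) (f : BiPoly) : shiftedCasimir m n f =
    (∑ i, elemDer i i (elemDer i i f)) + (2 : ℂ) • elemDer 0 0 f - (2 : ℂ) • elemDer 2 2 f -
      ((m : ℂ) ^ 2 + 2 * m + n ^ 2 + 2 * n) • f := by
  simp [shiftedCasimir]

/-- The eigenvalue of `shiftedCasimir m n` on the monomial of exponent `d`. -/
def casimirValue (m n : ℕ) (d : Fin 3 ⊕ Fin 3 →₀ ℕ) : ℤ :=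
  (∑ i, ((d (Sum.inl i) : ℤ) - d (Sum.inr i)) ^ 2) + 2 * ((d (Sum.inl 0) : ℤ) - d (Sum.inr 0)) -
    2 * ((d (Sum.inl 2) : ℤ) - d (Sum.inr 2)) - (m ^ 2 + 2 * m + n ^ 2 + 2 * n)

theorem coeff_shiftedCasimir (m n : ℕ) (f : BiPoly) (d : Fin 3 ⊕ Fin 3 →₀ ℕ) :
    coeff d (shiftedCasimir m n f) = casimirValue m n d * coeff d f := by
  have h : ∀ i g, coeff d (elemDer i i g) = ((d (Sum.inl i) : ℂ) - d (Sum.inr i)) * coeff d g :=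
    fun i g => by
      rw [elemDer_self, coeff_euler]
      congr 1
      simp [Pi.single_apply, sub_mul]
  rw [shiftedCasimir_apply, coeff_sub, coeff_sub, coeff_add, coeff_sum]
  simp only [coeff_smul, h, smul_eq_mul, casimirValue, Fin.sum_univ_three]
  push_cast
  ring

/-- For a monomial of bidegree `(m, n)`, the value `-casimirValue m n d` is twice a sum of products
and of multiples of exponents, each of which is nonnegative. -/
theorem eq_topExp_of_casimirValue_eq_zero {m n : ℕ} {d : Fin 3 ⊕ Fin 3 →₀ ℕ}
    (hd : d ∈ biExp m n) (h : casimirValue m n d = 0) : d = topExp m n := by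
  obtain ⟨h₁, h₂⟩ := hd
  rw [Fin.sum_univ_three] at h₁ h₂
  rw [casimirValue, Fin.sum_univ_three, ← h₁, ← h₂] at h
  push_cast at h
  generalize ha₀ : d (Sum.inl 0) = a₀ at *
  generalize ha₁ : d (Sum.inl 1) = a₁ at *
  generalize ha₂ : d (Sum.inl 2) = a₂ at *
  generalize hb₀ : d (Sum.inr 0) = b₀ at *
  generalize hb₁ : d (Sum.inr 1) = b₁ at *
  generalize hb₂ : d (Sum.inr 2) = b₂ at *
  have key : a₀ * a₁ + a₀ * a₂ + a₁ * a₂ + b₀ * b₁ + b₀ * b₂ + b₁ * b₂ + a₀ * b₀ + a₁ * b₁ +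
      a₂ * b₂ + a₁ + 2 * a₂ + 2 * b₀ + b₁ = 0 := by
    zify; linarith
  have e₁ : a₁ = 0 := by omega
  have e₂ : a₂ = 0 := by omega
  have e₃ : b₀ = 0 := by omega
  have e₄ : b₁ = 0 := by omega
  subst e₁ e₂ e₃ e₄
  ext (i | i) <;> fin_cases i <;> simp [topExp, *] <;> omega

/-- On harmonic polynomials the Casimir operator is scalar. -/
theorem shiftedCasimir_of_mem_harm {m n : ℕ} {f : BiPoly} (hf : f ∈ harm m n) :
    shiftedCasimir m n f = (-2 : ℂ) • (elemDer 1 0 (elemDer 0 1 f) + elemDer 2 0 (elemDer 0 2 f) +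
      elemDer 2 1 (elemDer 1 2 f)) := by
  obtain ⟨hX, hY⟩ := mem_biHom_iff_deg.1 hf.1
  have h := casimir f
  rw [LinearMap.mem_ker.1 hf.2, hX, hY, Derivation.map_smul, Derivation.map_smul, hX, hY] at h
  rw [shiftedCasimir_apply]
  simp only [smul_eq_C_mul, map_ofNat, map_neg, map_add, map_mul, map_pow] at h ⊢
  linear_combination h

/-- The zero eigenspace of `shiftedCasimir m n` on bidegree `(m, n)` is spanned by `x₀ᵐ y₂ⁿ`, so on
the quotient by an invariant subspace that contains this monomial the operator is injective. -/
theorem mem_of_shiftedCasimir_mem {m n : ℕ} {N : Submodule ℂ BiPoly}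
    (hN : ∀ f ∈ N, shiftedCasimir m n f ∈ N) (hv : monomial (topExp m n) 1 ∈ N) (f : BiPoly)
    (hf : f ∈ biHom m n) (hfN : shiftedCasimir m n f ∈ N) : f ∈ N := by
  induction hk : f.support.card using Nat.strong_induction_on generalizing f with
  | _ k ih =>
    by_cases h : ∀ d ∈ f.support, d = topExp m n
    · have : f = coeff (topExp m n) f • monomial (topExp m n) 1 := by
        ext d
        rw [coeff_smul, coeff_monomial]
        split_ifs with hd
        · simp [hd]
        · by_contra hne
          exact hd (h d (mem_support_iff.2 (by simpa using hne))).symm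
      rw [this]
      exact N.smul_mem _ hv
    · push Not at h
      obtain ⟨d, hd, hne⟩ := h
      -- Killing the eigencomponent of `d` shrinks the support and keeps the hypotheses.
      let g := shiftedCasimir m n f - (casimirValue m n d : ℂ) • f
      have hg : ∀ e, coeff e g = (casimirValue m n e - casimirValue m n d) * coeff e f :=
        fun e => by
          simp only [g, coeff_sub, coeff_smul, coeff_shiftedCasimir, smul_eq_mul]; ring
      have hsub : g.support ⊂ f.support := by
        refine Finset.ssubset_iff_subset_ne.2 ⟨fun e he => ?_, fun h => ?_⟩
        · rw [mem_support_iff, hg] at he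
          exact mem_support_iff.2 (right_ne_zero_of_mul he)
        · rw [← h, mem_support_iff, hg, sub_self, zero_mul] at hd
          exact hd rfl
      have hgN : g ∈ N := by
        refine ih _ (hk ▸ Finset.card_lt_card hsub) g ?_ ?_ rfl
        · exact mem_biHom.2 fun e he => mem_biHom.1 hf e (by
            rw [hg] at he; exact right_ne_zero_of_mul he)
        · rw [map_sub, map_smul]
          exact N.sub_mem (hN _ hfN) (N.smul_mem _ hfN)
      have hval : (casimirValue m n d : ℂ) ≠ 0 := fun h0 => hne
        (eq_topExp_of_casimirValue_eq_zero (mem_biHom.1 hf d (mem_support_iff.1 hd))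
          (by exact_mod_cast h0))
      have : (casimirValue m n d : ℂ) • f ∈ N := by
        have := N.sub_mem hfN hgN
        rwa [sub_sub_cancel] at this
      exact (N.smul_mem_iff hval).1 this

theorem glDer_mem_map_of_mem {m n : ℕ} {N : LieSubmodule ℂ sl3 (harm m n)} {f : BiPoly}
    (A : Matrix (Fin 3) (Fin 3) ℂ) (hf : f ∈ N.toSubmodule.map (harm m n).subtype) :
    glDer A f ∈ N.toSubmodule.map (harm m n).subtype := by
  -- Scalar matrices act on `harm m n` by scalars, so it suffices to treat trace zero.
  have hone : ∀ g ∈ harm m n, glDer 1 g = ((m : ℂ) - n) • g := fun g hg => by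
    obtain ⟨hX, hY⟩ := mem_biHom_iff_deg.1 hg.1
    rw [sub_smul, ← hX, ← hY, degX_apply, degY_apply, ← Finset.sum_sub_distrib, glDer_apply]
    simp [Matrix.one_apply, elemDer_apply]
  obtain ⟨f, hf, rfl⟩ := hf
  let A₀ : sl3 := ⟨A - (Matrix.trace A / 3) • 1, by
    change Matrix.trace (A - (Matrix.trace A / 3) • (1 : Matrix (Fin 3) (Fin 3) ℂ)) = 0
    rw [Matrix.trace_sub, Matrix.trace_smul, Matrix.trace_one]
    simp⟩
  have hA : A = A₀.1 + (Matrix.trace A / 3) • 1 := (sub_add_cancel _ _).symm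
  rw [hA, map_add, map_smul, Derivation.add_apply, Derivation.smul_apply, Submodule.subtype_apply,
    hone f.1 f.2]
  exact Submodule.add_mem _ ⟨⁅A₀, f⁆, N.lie_mem hf, rfl⟩
    (Submodule.smul_mem _ _ (Submodule.smul_mem _ _ ⟨f, hf, rfl⟩))

/-- A nonzero submodule contains a highest weight vector, which by the Casimir operator must be
`x₀ᵐ y₂ⁿ`. If the submodule were proper, a highest weight vector of the quotient would lift to a
vector that the Casimir operator forces into the submodule. -/
theorem harm_isIrreducible (m n : ℕ) : LieModule.IsIrreducible ℂ sl3 (harm m n) := by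
  have hupper : ∀ {i j : Fin 3}, i < j → ∃ X : sl3, IsStrictUpper X ∧
      ∀ f : harm m n, (⁅X, f⁆ : harm m n).1 = elemDer i j f.1 := fun {i j} hij => by
    refine ⟨LieAlgebra.SpecialLinear.single i j hij.ne 1, fun a b hab => ?_, fun f => ?_⟩
    · rw [LieAlgebra.SpecialLinear.val_single, Matrix.single_apply, if_neg]
      rintro ⟨rfl, rfl⟩
      exact absurd hij hab.not_gt
    · rw [coe_lie, LieAlgebra.SpecialLinear.val_single, glDer_single]
  have hnt : Nontrivial (harm m n) :=
    let ⟨v, hv, _⟩ := harm_hasHighestWeight m n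
    ⟨v, 0, hv⟩
  refine LieModule.IsIrreducible.mk fun N hN => ?_
  let N' := N.toSubmodule.map (harm m n).subtype
  have hmem : ∀ f : harm m n, f.1 ∈ N' ↔ f ∈ N := fun f => by
    simp [N']
  have helem : ∀ i j, ∀ f ∈ N', elemDer i j f ∈ N' := fun i j f hf => by
    rw [← glDer_single]; exact glDer_mem_map_of_mem _ hf
  have hcas : ∀ f : harm m n, (∀ X : sl3, IsStrictUpper X → ⁅X, f⁆ ∈ N) →
      shiftedCasimir m n f.1 ∈ N' := fun f hf => by
    have h : ∀ {i j : Fin 3}, i < j → elemDer i j f.1 ∈ N' := fun hij => by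
      obtain ⟨X, hX, hXf⟩ := hupper hij
      rw [← hXf, hmem]
      exact hf X hX
    rw [shiftedCasimir_of_mem_harm f.2]
    exact N'.smul_mem _ (N'.add_mem (N'.add_mem (helem _ _ _ (h (by decide)))
      (helem _ _ _ (h (by decide)))) (helem _ _ _ (h (by decide))))
  have hN' : ∀ f ∈ N', shiftedCasimir m n f ∈ N' := fun f hf => by
    obtain ⟨f, hfN, rfl⟩ := hf
    exact hcas f fun X _ => N.lie_mem hfN
  have hv : monomial (topExp m n) 1 ∈ N' := by
    have : Nontrivial N := (LieSubmodule.nontrivial_iff_ne_bot ℂ sl3 (harm m n)).2 hN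
    obtain ⟨f, hf0, hf⟩ := exists_ne_zero_strictUpper_lie_eq_zero (V := N)
    have hf0' : f.1.1 ≠ 0 := fun h => hf0 (Subtype.ext (Subtype.ext h))
    have hcf : shiftedCasimir m n f.1.1 = 0 := by
      have h : ∀ {i j : Fin 3}, i < j → elemDer i j f.1.1 = 0 := fun hij => by
        obtain ⟨X, hX, hXf⟩ := hupper hij
        rw [← hXf]
        exact congrArg (fun g : N => g.1.1) (hf X hX)
      rw [shiftedCasimir_of_mem_harm f.1.2, h (by decide), h (by decide), h (by decide)]
      simp
    have hsupp : ∀ d, coeff d f.1.1 ≠ 0 → d = topExp m n := fun d hd => by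
      have := coeff_shiftedCasimir m n f.1.1 d
      rw [hcf, coeff_zero, zero_eq_mul, or_iff_left hd] at this
      exact eq_topExp_of_casimirValue_eq_zero (mem_biHom.1 f.1.2.1 d hd) (by exact_mod_cast this)
    have hfv : f.1.1 = coeff (topExp m n) f.1.1 • monomial (topExp m n) 1 := by
      ext d
      rw [coeff_smul, coeff_monomial]
      split_ifs with hd
      · simp [hd]
      · by_contra hne
        exact hd (hsupp d (by simpa using hne)).symm
    have hc : coeff (topExp m n) f.1.1 ≠ 0 := fun h => hf0' (by rw [hfv, h, zero_smul])
    refine (N'.smul_mem_iff hc).1 ?_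
    rw [← hfv]
    exact (hmem f.1).2 f.2
  by_contra hne
  have : Nontrivial (harm m n ⧸ N) := Submodule.Quotient.nontrivial_iff.2 fun h =>
    hne (LieSubmodule.toSubmodule_injective h)
  obtain ⟨q, hq0, hq⟩ := exists_ne_zero_strictUpper_lie_eq_zero (V := harm m n ⧸ N)
  obtain ⟨f, rfl⟩ := Submodule.Quotient.mk_surjective N.toSubmodule q
  refine hq0 ((Submodule.Quotient.mk_eq_zero _).2 ((hmem f).1 ?_))
  refine mem_of_shiftedCasimir_mem hN' hv f.1 f.2.1 (hcas f fun X hX => ?_)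
  exact (Submodule.Quotient.mk_eq_zero N.toSubmodule).1 (hq X hX)

end BiPoly

/-! ### The group action on the polynomial model -/

theorem MvPolynomial.pderiv_bind₁ {σ τ R : Type*} [CommSemiring R] [Fintype σ]
    (u : σ → MvPolynomial τ R) (t : τ) (f : MvPolynomial σ R) :
    pderiv t (bind₁ u f) = ∑ s, pderiv t (u s) * bind₁ u (pderiv s f) := by
  classical
  induction f using MvPolynomial.induction_on with
  | C a => simp
  | add f g hf hg => simp [hf, hg, mul_add, Finset.sum_add_distrib]
  | mul_X f s hf =>
    simp only [map_mul, pderiv_mul, hf, pderiv_X, bind₁_X_right, map_add, mul_add,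
      Finset.sum_add_distrib, Finset.sum_mul, Pi.single_apply]
    simp [apply_ite (bind₁ u), mul_assoc, mul_comm]

namespace BiPoly

/-- The substitution by which `g` acts: naturally on the `x_i` and contragrediently on the
`y_i`. -/
noncomputable def glHom (g : SL3) : BiPoly →ₐ[ℂ] BiPoly :=
  bind₁ (Sum.elim (fun k => ∑ i, g.1 i k • X (Sum.inl i))
    (fun k => ∑ j, (g⁻¹).1 k j • X (Sum.inr j)))

theorem glHom_X_inl (g : SL3) (k : Fin 3) :
    glHom g (X (Sum.inl k)) = ∑ i, g.1 i k • X (Sum.inl i) := by simp [glHom]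

theorem glHom_X_inr (g : SL3) (k : Fin 3) :
    glHom g (X (Sum.inr k)) = ∑ j, (g⁻¹).1 k j • X (Sum.inr j) := by
  simp only [glHom, bind₁_X_right, Sum.elim_inr]

theorem glHom_one : glHom 1 = AlgHom.id ℂ BiPoly := by
  refine MvPolynomial.algHom_ext fun s => ?_
  rcases s with k | k
  · rw [glHom_X_inl]
    change ∑ i, (1 : Matrix (Fin 3) (Fin 3) ℂ) i k • _ = _
    simp [Matrix.one_apply]
  · rw [glHom_X_inr, inv_one]
    change ∑ i, (1 : Matrix (Fin 3) (Fin 3) ℂ) k i • _ = _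
    simp [Matrix.one_apply]

theorem glHom_mul (g h : SL3) : glHom (g * h) = (glHom g).comp (glHom h) := by
  refine MvPolynomial.algHom_ext fun s => ?_
  rw [AlgHom.comp_apply]
  rcases s with k | k
  · rw [glHom_X_inl, glHom_X_inl]
    change ∑ i, (g.1 * h.1) i k • _ = _
    simp only [map_sum, map_smul, glHom_X_inl, Matrix.mul_apply, Finset.sum_smul, Finset.smul_sum,
      smul_smul]
    rw [Finset.sum_comm]
    simp only [mul_comm]
  · rw [glHom_X_inr, glHom_X_inr, mul_inv_rev]
    change ∑ j, ((h⁻¹).1 * (g⁻¹).1) k j • _ = _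
    simp only [map_sum, map_smul, glHom_X_inr, Matrix.mul_apply, Finset.sum_smul, Finset.smul_sum,
      smul_smul]
    rw [Finset.sum_comm]

theorem pderiv_inl_glHom (g : SL3) (k : Fin 3) (f : BiPoly) :
    pderiv (Sum.inl k) (glHom g f) = ∑ j, g.1 k j • glHom g (pderiv (Sum.inl j) f) := by
  rw [glHom, pderiv_bind₁, Fintype.sum_sum_type]
  simp [pderiv_X, Pi.single_apply, Derivation.map_smul]

theorem pderiv_inr_glHom (g : SL3) (k : Fin 3) (f : BiPoly) :
    pderiv (Sum.inr k) (glHom g f) = ∑ j, (g⁻¹).1 j k • glHom g (pderiv (Sum.inr j) f) := by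
  rw [glHom, pderiv_bind₁, Fintype.sum_sum_type]
  simp [pderiv_X, Pi.single_apply, Derivation.map_smul, -Matrix.SpecialLinearGroup.coe_inv]

theorem sum_mul_inv (g : SL3) (i j : Fin 3) :
    ∑ k, (g⁻¹).1 i k * g.1 k j = if i = j then 1 else 0 := by
  have : (g⁻¹).1 * g.1 = 1 := by
    rw [← Matrix.SpecialLinearGroup.coe_mul, inv_mul_cancel]; rfl
  rw [← Matrix.mul_apply, this, Matrix.one_apply]

theorem laplacian_glHom (g : SL3) (f : BiPoly) :
    laplacian (glHom g f) = glHom g (laplacian f) := by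
  simp only [laplacian_apply, pderiv_inr_glHom, map_sum, Derivation.map_smul, pderiv_inl_glHom,
    Finset.smul_sum, smul_smul]
  rw [Finset.sum_comm]
  have h : ∀ i j, ∑ k, ((g⁻¹).1 i k * g.1 k j) •
      glHom g (pderiv (Sum.inl j) (pderiv (Sum.inr i) f)) =
      if i = j then glHom g (pderiv (Sum.inl j) (pderiv (Sum.inr i) f)) else 0 := fun i j => by
    rw [← Finset.sum_smul, sum_mul_inv]; split_ifs <;> simp
  refine Finset.sum_congr rfl fun i _ => ?_
  rw [Finset.sum_comm]
  simp [h, -Matrix.SpecialLinearGroup.coe_inv]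

theorem degX_glHom (g : SL3) (f : BiPoly) : degX (glHom g f) = glHom g (degX f) := by
  simp only [degX_apply, pderiv_inl_glHom, map_sum, map_mul, glHom_X_inl, Finset.mul_sum,
    Finset.sum_mul]
  rw [Finset.sum_comm]
  simp

theorem degY_glHom (g : SL3) (f : BiPoly) : degY (glHom g f) = glHom g (degY f) := by
  simp only [degY_apply, pderiv_inr_glHom, map_sum, map_mul, glHom_X_inr, Finset.mul_sum,
    Finset.sum_mul]
  rw [Finset.sum_comm]
  simp

theorem glHom_mem_biHom {m n : ℕ} {f : BiPoly} (g : SL3) (hf : f ∈ biHom m n) :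
    glHom g f ∈ biHom m n := by
  rw [mem_biHom_iff_deg] at hf ⊢
  rw [degX_glHom, degY_glHom, hf.1, hf.2, map_smul, map_smul]
  exact ⟨rfl, rfl⟩

theorem glHom_mem_harm {m n : ℕ} {f : BiPoly} (g : SL3) (hf : f ∈ harm m n) :
    glHom g f ∈ harm m n :=
  Submodule.mem_inf.2 ⟨glHom_mem_biHom g hf.1, LinearMap.mem_ker.2 <| by
    rw [laplacian_glHom, LinearMap.mem_ker.1 hf.2, map_zero]⟩

/-- The representation of `SL₃(ℂ)` on harmonic polynomials. -/
noncomputable def harmRep (m n : ℕ) : Representation ℂ SL3 (harm m n) where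
  toFun g := (glHom g).toLinearMap.restrict fun _ hf => glHom_mem_harm g hf
  map_one' := by
    ext f
    simp [glHom_one]
  map_mul' g h := by
    ext1 f
    exact Subtype.ext (by
      rw [Module.End.mul_apply]
      exact congrArg (fun φ => φ f.1) (glHom_mul g h))

/-! ### Integration of the Lie algebra action -/

open Finset.HasAntidiagonal

/-- The Leibniz rule for the divided powers of a derivation. -/
theorem divided_iterate_mul (D : Derivation ℂ BiPoly BiPoly) (f g : BiPoly) (k : ℕ) :
    (k.factorial : ℂ)⁻¹ • D^[k] (f * g) = ∑ ij ∈ antidiagonal k,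
      ((ij.1.factorial : ℂ)⁻¹ • D^[ij.1] f) * ((ij.2.factorial : ℂ)⁻¹ • D^[ij.2] g) := by
  let a : ℕ → BiPoly → BiPoly := fun k f => (k.factorial : ℂ)⁻¹ • D^[k] f
  have ha : ∀ k f, D (a k f) = ((k + 1 : ℕ) : ℂ) • a (k + 1) f := fun k f => by
    simp only [a]
    rw [Derivation.map_smul, Function.iterate_succ_apply', smul_smul, Nat.factorial_succ]
    congr 1
    push_cast
    field_simp
  change a k (f * g) = ∑ ij ∈ antidiagonal k, a ij.1 f * a ij.2 g
  induction k with
  | zero => simp [a]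
  | succ k ih =>
    have hk : ((k + 1 : ℕ) : ℂ) ≠ 0 := Nat.cast_ne_zero.2 k.succ_ne_zero
    refine smul_right_injective _ hk ?_
    change ((k + 1 : ℕ) : ℂ) • a (k + 1) (f * g) = ((k + 1 : ℕ) : ℂ) • _
    have hsplit : ((k + 1 : ℕ) : ℂ) • ∑ ij ∈ antidiagonal (k + 1), a ij.1 f * a ij.2 g =
        (∑ ij ∈ antidiagonal (k + 1), (ij.1 : ℂ) • (a ij.1 f * a ij.2 g)) +
        ∑ ij ∈ antidiagonal (k + 1), (ij.2 : ℂ) • (a ij.1 f * a ij.2 g) := by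
      rw [← Finset.sum_add_distrib, Finset.smul_sum]
      refine Finset.sum_congr rfl fun ij hij => ?_
      rw [← add_smul, ← Nat.cast_add, mem_antidiagonal.1 hij]
    rw [hsplit, Finset.Nat.sum_antidiagonal_succ, Finset.Nat.sum_antidiagonal_succ', ← ha, ih,
      map_sum]
    simp only [Nat.cast_zero, zero_smul, zero_add]
    rw [← Finset.sum_add_distrib]
    refine Finset.sum_congr rfl fun ij _ => ?_
    clear_value a
    rw [Derivation.leibniz, ha, ha, smul_eq_mul, smul_eq_mul, add_comm, mul_smul_comm,
      mul_smul_comm, mul_comm (a ij.2 g)]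

/-- The exponential series of a derivation is multiplicative, by the Leibniz rule and the
Cauchy product formula. Convergence is tested at each point `p`. -/
theorem hasSum_eval_iterate_mul {D : Derivation ℂ BiPoly BiPoly} {p : Fin 3 ⊕ Fin 3 → ℂ}
    {f g : BiPoly} {a b : ℂ}
    (hf : HasSum (fun k : ℕ => (k.factorial : ℂ)⁻¹ * eval p (D^[k] f)) a)
    (hg : HasSum (fun k : ℕ => (k.factorial : ℂ)⁻¹ * eval p (D^[k] g)) b) :
    HasSum (fun k : ℕ => (k.factorial : ℂ)⁻¹ * eval p (D^[k] (f * g))) (a * b) := by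
  have h : ∀ k : ℕ, (k.factorial : ℂ)⁻¹ * eval p (D^[k] (f * g)) =
      ∑ ij ∈ antidiagonal k, ((ij.1.factorial : ℂ)⁻¹ * eval p (D^[ij.1] f)) *
        ((ij.2.factorial : ℂ)⁻¹ * eval p (D^[ij.2] g)) := fun k => by
    have := congrArg (eval p) (divided_iterate_mul D f g k)
    simpa only [smul_eval, map_sum, map_mul] using this
  simp only [h]
  have hs := summable_norm_sum_mul_antidiagonal_of_summable_norm hf.summable.norm hg.summable.norm
  rw [← hf.tsum_eq, ← hg.tsum_eq, tsum_mul_tsum_eq_tsum_sum_antidiagonal_of_summable_norm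
    hf.summable.norm hg.summable.norm]
  exact hs.of_norm.hasSum

theorem iterate_glDer_X_inl (A : Matrix (Fin 3) (Fin 3) ℂ) (k : ℕ) (j : Fin 3) :
    (glDer A)^[k] (X (Sum.inl j)) = ∑ i, (A ^ k) i j • X (Sum.inl i) := by
  induction k with
  | zero => simp [Matrix.one_apply]
  | succ k ih =>
    rw [Function.iterate_succ_apply', ih, map_sum]
    simp only [Derivation.map_smul, glDer_X_inl, pow_succ', Matrix.mul_apply, Finset.sum_smul,
      Finset.smul_sum, smul_smul]
    rw [Finset.sum_comm]
    simp only [mul_comm]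

theorem iterate_glDer_X_inr (A : Matrix (Fin 3) (Fin 3) ℂ) (k : ℕ) (j : Fin 3) :
    (glDer A)^[k] (X (Sum.inr j)) = ∑ i, ((-A) ^ k) j i • X (Sum.inr i) := by
  induction k with
  | zero => simp [Matrix.one_apply]
  | succ k ih =>
    rw [Function.iterate_succ_apply', ih, map_sum]
    simp only [Derivation.map_smul, glDer_X_inr, pow_succ, Matrix.mul_apply, Finset.sum_smul,
      Finset.smul_sum, smul_smul, smul_neg, Matrix.neg_apply, mul_neg, neg_smul]
    rw [Finset.sum_comm]
    simp

theorem hasSum_exp_apply (A : Matrix (Fin 3) (Fin 3) ℂ) (i j : Fin 3) :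
    HasSum (fun k : ℕ => (k.factorial : ℂ)⁻¹ * (A ^ k) i j) (NormedSpace.exp A i j) :=
  Pi.hasSum.1 (Pi.hasSum.1 (Matrix.hasSum_exp A) i) j

/-- For `g = exp A`, the substitution by `g` is the exponential of the derivation by which `A`
acts. -/
theorem hasSum_eval_iterate_glDer {A : Matrix (Fin 3) (Fin 3) ℂ} {g : SL3}
    (hg : g.1 = NormedSpace.exp A) (p : Fin 3 ⊕ Fin 3 → ℂ) (f : BiPoly) :
    HasSum (fun k : ℕ => (k.factorial : ℂ)⁻¹ * eval p ((glDer A)^[k] f)) (eval p (glHom g f)) := by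
  have hinv : (g⁻¹).1 = NormedSpace.exp (-A) := by
    rw [Matrix.exp_neg, ← hg]
    refine (Matrix.inv_eq_left_inv ?_).symm
    rw [← Matrix.SpecialLinearGroup.coe_mul, inv_mul_cancel]; rfl
  induction f using MvPolynomial.induction_on with
  | C a =>
    have : ∀ k : ℕ, k ≠ 0 → (k.factorial : ℂ)⁻¹ * eval p ((glDer A)^[k] (C a)) = 0 := fun k hk => by
      obtain ⟨k, rfl⟩ := Nat.exists_eq_succ_of_ne_zero hk
      rw [Function.iterate_succ_apply, derivation_C, iterate_map_zero]
      simp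
    convert hasSum_single 0 this using 1
    simp [glHom]
  | add f g hf hg =>
    convert hf.add hg using 1
    · ext k
      rw [iterate_map_add, map_add, mul_add]
    · simp
  | mul_X f s hf =>
    rw [map_mul, map_mul]
    refine hasSum_eval_iterate_mul hf ?_
    rcases s with j | j
    · simp only [glHom_X_inl, iterate_glDer_X_inl, map_sum, smul_eval, eval_X, hg, Finset.mul_sum,
        ← mul_assoc]
      exact hasSum_sum fun i _ => (hasSum_exp_apply A i j).mul_right _
    · simp only [glHom_X_inr, iterate_glDer_X_inr, map_sum, smul_eval, eval_X, hinv,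
        Finset.mul_sum, ← mul_assoc]
      exact hasSum_sum fun i _ => (hasSum_exp_apply (-A) j i).mul_right _

theorem harmRep_integrates (m n : ℕ) (A : sl3) (g : SL3)
    (hg : (g : Matrix (Fin 3) (Fin 3) ℂ) = NormedSpace.exp (A : Matrix (Fin 3) (Fin 3) ℂ)) :
    harmRep m n g = endExp (LieModule.toEnd ℂ sl3 (harm m n) A) := by
  ext1 f
  refine Subtype.ext (MvPolynomial.funext fun p => ?_)
  let φ : harm m n →ₗ[ℂ] ℂ := (aeval p).toLinearMap ∘ₗ (harm m n).subtype
  have h := hasSum_endExp (LieModule.toEnd ℂ sl3 (harm m n) A) φ f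
  have h' := hasSum_eval_iterate_glDer hg p f.1
  refine h'.unique ?_
  have hT : ∀ (k : ℕ) (f : harm m n),
      ((LieModule.toEnd ℂ sl3 (harm m n) A ^ k) f).1 = (glDer A.1)^[k] f.1 := fun k => by
    induction k with
    | zero => exact fun f => rfl
    | succ k ih =>
      intro f
      rw [pow_succ, Module.End.mul_apply, ih, Function.iterate_succ_apply]
      rfl
  have hφ : ∀ f, φ f = eval p f.1 := fun f => rfl
  simp only [hφ, hT] at h
  exact h

end BiPoly

/-- The model as an integrated highest weight representation. -/
noncomputable def harmonicRep (m n : ℕ) : HighestWeightRep m n where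
  V := BiPoly.harm m n
  simple := BiPoly.harm_isIrreducible m n
  hasHighestWeight := BiPoly.harm_hasHighestWeight m n
  π := BiPoly.harmRep m n
  integrates := BiPoly.harmRep_integrates m n

/-! ### Complete symmetric functions -/

/-- The complete homogeneous symmetric function of degree `k` of `t₀, t₁, t₂`, for `k : ℤ`; it
vanishes in negative degree. -/
noncomputable def completeSymm (t : Fin 3 → ℂ) : ℤ → ℂ
  | Int.ofNat k => ∑ a ∈ Finset.finsuppAntidiag Finset.univ k, ∏ i, t i ^ a i
  | Int.negSucc _ => 0

theorem completeSymm_natCast (t : Fin 3 → ℂ) (k : ℕ) :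
    completeSymm t k = ∑ a ∈ Finset.finsuppAntidiag Finset.univ k, ∏ i, t i ^ a i := rfl

/-- The recursion expressing `∏ (1 - t_i z) · ∑ h_k z^k = 1`. -/
theorem completeSymm_succ (t : Fin 3 → ℂ) (k : ℕ) :
    completeSymm t (k + 1) = (t 0 + t 1 + t 2) * completeSymm t k -
      (t 0 * t 1 + t 0 * t 2 + t 1 * t 2) * completeSymm t (k - 1) +
      t 0 * t 1 * t 2 * completeSymm t (k - 2) := by
  let H : PowerSeries ℂ := ∏ i, PowerSeries.mk (t i ^ ·)
  have hH : ∀ k : ℕ, PowerSeries.coeff k H = completeSymm t k := fun k => by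
    rw [completeSymm_natCast, PowerSeries.coeff_prod]
    simp
  have hgeom : ∀ i, (1 - PowerSeries.C (t i) * PowerSeries.X) * PowerSeries.mk (t i ^ ·) = 1 :=
    fun i => by
      ext n
      rw [sub_mul, one_mul, mul_assoc, map_sub, PowerSeries.coeff_C_mul, PowerSeries.coeff_mk]
      cases n with
      | zero => simp
      | succ n => simp [PowerSeries.coeff_succ_X_mul, pow_succ', PowerSeries.coeff_one]
  have hprod : (1 - PowerSeries.C (t 0) * PowerSeries.X) * (1 - PowerSeries.C (t 1) * PowerSeries.X)
      * (1 - PowerSeries.C (t 2) * PowerSeries.X) * H = 1 := by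
    have := congrArg₂ (· * ·) (congrArg₂ (· * ·) (hgeom 0) (hgeom 1)) (hgeom 2)
    simp only [mul_one] at this
    refine Eq.trans ?_ this
    rw [show H = _ from Fin.prod_univ_three _]
    ring
  have hexp : H = 1 + PowerSeries.C (t 0 + t 1 + t 2) * (PowerSeries.X * H) -
      PowerSeries.C (t 0 * t 1 + t 0 * t 2 + t 1 * t 2) * (PowerSeries.X * (PowerSeries.X * H)) +
      PowerSeries.C (t 0 * t 1 * t 2) *
        (PowerSeries.X * (PowerSeries.X * (PowerSeries.X * H))) := by
    simp only [map_add, map_mul]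
    linear_combination hprod
  have hc := congrArg (PowerSeries.coeff (k + 1)) hexp
  rw [map_add, map_sub, map_add, PowerSeries.coeff_C_mul, PowerSeries.coeff_C_mul,
    PowerSeries.coeff_C_mul, PowerSeries.coeff_succ_X_mul, PowerSeries.coeff_succ_X_mul,
    PowerSeries.coeff_succ_X_mul, PowerSeries.coeff_one, if_neg k.succ_ne_zero, zero_add] at hc
  have h1 : PowerSeries.coeff k (PowerSeries.X * H) = completeSymm t (k - 1) := by
    cases k with
    | zero => rw [PowerSeries.coeff_zero_X_mul]; rfl
    | succ k =>
      rw [PowerSeries.coeff_succ_X_mul, hH]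
      congr 1; push_cast; ring
  have h2 : PowerSeries.coeff k (PowerSeries.X * (PowerSeries.X * H)) = completeSymm t (k - 2) := by
    rcases k with _ | _ | k
    · rw [PowerSeries.coeff_zero_X_mul]; rfl
    · rw [PowerSeries.coeff_succ_X_mul, PowerSeries.coeff_zero_X_mul]; rfl
    · rw [PowerSeries.coeff_succ_X_mul, PowerSeries.coeff_succ_X_mul, hH]
      congr 1; push_cast; ring
  rw [h1, h2, hH, hH] at hc
  exact_mod_cast hc

/-- The value at `diag(t₀, t₁, t₂)` of the character of highest weight `a ϖ₁ + b ϖ₂`. -/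
noncomputable def weylChar (t : Fin 3 → ℂ) (a b : ℤ) : ℂ :=
  completeSymm t a * completeSymm t⁻¹ b - completeSymm t (a - 1) * completeSymm t⁻¹ (b - 1)

theorem weylChar_of_neg (t : Fin 3 → ℂ) {a b : ℤ} (h : a < 0 ∨ b < 0) : weylChar t a b = 0 := by
  have hneg : ∀ (s : Fin 3 → ℂ) {c : ℤ}, c < 0 → completeSymm s c = 0 := fun s c hc => by
    obtain ⟨k, rfl⟩ := Int.eq_negSucc_of_lt_zero hc
    rfl
  rcases h with h | h
  · rw [weylChar, hneg t h, hneg t (by omega : a - 1 < 0)]; ring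
  · rw [weylChar, hneg t⁻¹ h, hneg t⁻¹ (by omega : b - 1 < 0)]; ring

theorem sum_pairs_eq_sum_inv {t : Fin 3 → ℂ} (ht : t 0 * t 1 * t 2 = 1) :
    t 0 * t 1 + t 0 * t 2 + t 1 * t 2 = ∑ i, (t i)⁻¹ := by
  have h2 : t 2 ≠ 0 := fun h => by simp [h] at ht
  have h1 : t 1 ≠ 0 := fun h => by simp [h] at ht
  have h0 : t 0 ≠ 0 := fun h => by simp [h] at ht
  rw [Fin.sum_univ_three]
  field_simp
  linear_combination (t 0 * t 1 + t 0 * t 2 + t 1 * t 2) * ht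

theorem completeSymm_succ_of_prod_eq_one {t : Fin 3 → ℂ} (ht : t 0 * t 1 * t 2 = 1)
    (k : ℕ) :
    completeSymm t (k + 1) = (∑ i, t i) * completeSymm t k -
      (∑ i, (t i)⁻¹) * completeSymm t (k - 1) + completeSymm t (k - 2) := by
  rw [completeSymm_succ, ht, sum_pairs_eq_sum_inv ht, Fin.sum_univ_three t, one_mul]

theorem prod_inv_eq_one {t : Fin 3 → ℂ} (ht : t 0 * t 1 * t 2 = 1) :
    t⁻¹ 0 * t⁻¹ 1 * t⁻¹ 2 = 1 := by
  simp only [Pi.inv_apply, ← mul_inv, ht, inv_one]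

/-- Pieri's rule for the product with the natural character. -/
theorem sum_mul_weylChar {t : Fin 3 → ℂ} (ht : t 0 * t 1 * t 2 = 1) (m n : ℕ) :
    weylChar t m n * ∑ i, t i =
    weylChar t (m + 1) n + weylChar t m (n - 1) + weylChar t (m - 1) (n + 1) := by
  have h₁ := completeSymm_succ_of_prod_eq_one ht m
  have h₂ := completeSymm_succ_of_prod_eq_one (prod_inv_eq_one ht) n
  simp only [Pi.inv_apply, inv_inv] at h₂
  simp only [weylChar, add_sub_cancel_right, sub_sub, one_add_one_eq_two]
  rw [h₁, h₂]
  ring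

/-- Pieri's rule for the product with the dual of the natural character. -/
theorem sum_inv_mul_weylChar {t : Fin 3 → ℂ} (ht : t 0 * t 1 * t 2 = 1) (m n : ℕ) :
    weylChar t m n * ∑ i, (t i)⁻¹ =
    weylChar t m (n + 1) + weylChar t (m - 1) n + weylChar t (m + 1) (n - 1) := by
  have h₁ := completeSymm_succ_of_prod_eq_one ht m
  have h₂ := completeSymm_succ_of_prod_eq_one (prod_inv_eq_one ht) n
  simp only [Pi.inv_apply, inv_inv] at h₂
  simp only [weylChar, add_sub_cancel_right, sub_sub, one_add_one_eq_two]
  rw [h₁, h₂]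
  ring

/-! ### Characters of the model -/

/-- Additivity of the trace on a short exact sequence `0 → K → V → W → 0`. -/
theorem LinearMap.trace_eq_add_of_exact {F K V W : Type*} [Field F] [AddCommGroup K] [Module F K]
    [AddCommGroup V] [Module F V] [AddCommGroup W] [Module F W] [FiniteDimensional F K]
    [FiniteDimensional F V] [FiniteDimensional F W] {ι : K →ₗ[F] V} {φ : V →ₗ[F] W}
    (hι : Function.Injective ι) (hφ : Function.Surjective φ)
    (hex : LinearMap.range ι = LinearMap.ker φ) {A : K →ₗ[F] K} {B : V →ₗ[F] V} {C : W →ₗ[F] W}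
    (hAB : B ∘ₗ ι = ι ∘ₗ A) (hBC : φ ∘ₗ B = C ∘ₗ φ) :
    LinearMap.trace F V B = LinearMap.trace F K A + LinearMap.trace F W C := by
  obtain ⟨s, hs⟩ := φ.exists_rightInverse_of_surjective (LinearMap.range_eq_top.2 hφ)
  obtain ⟨r, hr⟩ := ι.exists_leftInverse_of_injective (LinearMap.ker_eq_bot.2 hι)
  let p := r ∘ₗ (LinearMap.id - s ∘ₗ φ)
  have hφι : φ ∘ₗ ι = 0 := LinearMap.range_le_ker_iff.1 hex.le
  have hp : ι ∘ₗ p = LinearMap.id - s ∘ₗ φ := by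
    ext x
    obtain ⟨k, hk⟩ : x - s (φ x) ∈ LinearMap.range ι := by
      rw [hex, LinearMap.mem_ker, map_sub, ← LinearMap.comp_apply φ s, hs]
      simp
    change ι (r (x - s (φ x))) = x - s (φ x)
    rw [← hk, ← LinearMap.comp_apply r ι, hr]
    rfl
  have hpι : p ∘ₗ ι = LinearMap.id := by
    simp only [p, LinearMap.comp_assoc, LinearMap.sub_comp, hφι, LinearMap.comp_zero, sub_zero,
      LinearMap.id_comp, hr]
  have hB : B = B ∘ₗ (ι ∘ₗ p) + B ∘ₗ (s ∘ₗ φ) := by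
    rw [hp, ← LinearMap.comp_add, sub_add_cancel, LinearMap.comp_id]
  rw [hB, map_add]
  congr 1
  · rw [← LinearMap.comp_assoc, hAB, LinearMap.comp_assoc, LinearMap.trace_comp_comm',
      LinearMap.comp_assoc, hpι, LinearMap.comp_id]
  · rw [← LinearMap.comp_assoc, LinearMap.trace_comp_comm', ← LinearMap.comp_assoc, hBC,
      LinearMap.comp_assoc, hs, LinearMap.comp_id]

namespace BiPoly

theorem coeff_laplacian (f : BiPoly) (d : Fin 3 ⊕ Fin 3 →₀ ℕ) :
    coeff d (laplacian f) = ∑ i, ((d (Sum.inl i) + 1 : ℂ) * (d (Sum.inr i) + 1)) *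
      coeff (d + Finsupp.single (Sum.inl i) 1 + Finsupp.single (Sum.inr i) 1) f := by
  rw [laplacian_apply, coeff_sum]
  refine Finset.sum_congr rfl fun i _ => ?_
  rw [coeff_pderiv, coeff_pderiv]
  simp
  ring

theorem add_single_mem_biExp_iff {m n : ℕ} {d : Fin 3 ⊕ Fin 3 →₀ ℕ} (i : Fin 3) :
    d + Finsupp.single (Sum.inl i) 1 + Finsupp.single (Sum.inr i) 1 ∈ biExp m n ↔
      (∑ j, d (Sum.inl j)) + 1 = m ∧ (∑ j, d (Sum.inr j)) + 1 = n := by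
  simp [biExp, Finset.sum_add_distrib, Finsupp.single_apply]

theorem laplacian_mem_biHom {m n : ℕ} {f : BiPoly} (hf : f ∈ biHom (m + 1) (n + 1)) :
    laplacian f ∈ biHom m n := by
  refine mem_biHom.2 fun d hd => ?_
  rw [coeff_laplacian] at hd
  obtain ⟨i, _, hi⟩ := Finset.exists_ne_zero_of_sum_ne_zero hd
  have := (add_single_mem_biExp_iff i).1 (mem_biHom.1 hf _ (right_ne_zero_of_mul hi))
  exact ⟨by omega, by omega⟩

theorem laplacian_eq_zero_of_mem_biHom {m n : ℕ} {f : BiPoly} (hf : f ∈ biHom m n)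
    (hmn : m = 0 ∨ n = 0) : laplacian f = 0 := by
  ext d
  rw [coeff_laplacian, coeff_zero]
  refine Finset.sum_eq_zero fun i _ => ?_
  by_contra h
  have := (add_single_mem_biExp_iff i).1 (mem_biHom.1 hf _ (right_ne_zero_of_mul h))
  omega

/-- The contraction is surjective: modulo monomials with smaller exponents of `x₁` and `x₂`, the
image of `x₀ y₀ u` is a nonzero multiple of the monomial `u`. -/
theorem biHom_le_map_laplacian (m n : ℕ) :
    biHom m n ≤ (biHom (m + 1) (n + 1)).map laplacian := by
  have key : ∀ (k : ℕ) (e : Fin 3 ⊕ Fin 3 →₀ ℕ), e (Sum.inl 1) + e (Sum.inl 2) = k →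
      e ∈ biExp m n → monomial e 1 ∈ (biHom (m + 1) (n + 1)).map laplacian := fun k => by
    induction k using Nat.strong_induction_on with
    | _ k ih =>
      intro e hk he
      let u := e + Finsupp.single (Sum.inl 0) 1 + Finsupp.single (Sum.inr 0) 1
      have hu : monomial u (1 : ℂ) ∈ biHom (m + 1) (n + 1) :=
        monomial_mem_biHom ((add_single_mem_biExp_iff 0).2 ⟨by rw [he.1], by rw [he.2]⟩)
      have hlow : ∀ i, i ≠ 0 → pderiv (Sum.inl i) (pderiv (Sum.inr i) (monomial u (1 : ℂ))) ∈
          (biHom (m + 1) (n + 1)).map laplacian := fun i hi => by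
        have hi' : (0 : Fin 3) ≠ i := hi.symm
        rw [pderiv_monomial, pderiv_monomial]
        by_cases hz : u (Sum.inl i) = 0 ∨ u (Sum.inr i) = 0
        · rcases hz with h | h <;> simp [h]
        · push Not at hz
          rw [← mul_one (1 * _ * _), ← smul_eq_mul, ← smul_monomial]
          refine Submodule.smul_mem _ _ (ih _ ?_ _ rfl ?_)
          · fin_cases i
            · exact absurd rfl hi
            · simp [u] at hz ⊢; omega
            · simp [u] at hz ⊢; omega
          · obtain ⟨he₁, he₂⟩ := he
            rw [Fin.sum_univ_three] at he₁ he₂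
            fin_cases i
            · exact absurd rfl hi
            · simp [u, biExp, Fin.sum_univ_three] at hz ⊢; omega
            · simp [u, biExp, Fin.sum_univ_three] at hz ⊢; omega
      have h0 : pderiv (Sum.inl 0) (pderiv (Sum.inr 0) (monomial u (1 : ℂ))) =
          ((e (Sum.inl 0) + 1 : ℂ) * (e (Sum.inr 0) + 1)) • monomial e 1 := by
        rw [pderiv_monomial, pderiv_monomial, smul_monomial]
        congr 1
        · congr 1
          ext s
          simp [u]
        · simp [u]; ring
      have hc : ((e (Sum.inl 0) + 1 : ℂ) * (e (Sum.inr 0) + 1)) ≠ 0 :=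
        mul_ne_zero (Nat.cast_add_one_ne_zero _) (Nat.cast_add_one_ne_zero _)
      refine (Submodule.smul_mem_iff _ hc).1 ?_
      have hl := laplacian_apply (monomial u 1)
      rw [Fin.sum_univ_three, h0, add_assoc] at hl
      rw [eq_sub_of_add_eq hl.symm]
      exact Submodule.sub_mem _ ⟨_, hu, rfl⟩
        (Submodule.add_mem _ (hlow 1 (by decide)) (hlow 2 (by decide)))
  rw [biHom, restrictSupport_eq_span, Submodule.span_le]
  rintro _ ⟨e, he, rfl⟩
  exact key _ e rfl he

theorem sum_biExp_prod (t u : Fin 3 → ℂ) (m n : ℕ) [Fintype (biExp m n)] :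
    ∑ e : biExp m n, (∏ i, t i ^ e.1 (Sum.inl i)) * ∏ i, u i ^ e.1 (Sum.inr i) =
      completeSymm t m * completeSymm u n := by
  have hmem : ∀ (k : ℕ) (a : Fin 3 →₀ ℕ),
      a ∈ Finset.finsuppAntidiag Finset.univ k ↔ ∑ i, a i = k := fun k a => by
    simp [Finset.mem_finsuppAntidiag]
  rw [completeSymm_natCast, completeSymm_natCast, Finset.sum_mul_sum, ← Finset.sum_product']
  let E := Finsupp.sumFinsuppEquivProdFinsupp (α := Fin 3) (β := Fin 3) (γ := ℕ)
  refine Finset.sum_bij (fun e _ => E e.1) (fun e _ => ?_)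
    (fun e _ e' _ h => Subtype.ext (E.injective h)) (fun p hp => ?_) (fun e _ => rfl)
  · exact Finset.mem_product.2 ⟨(hmem m _).2 e.2.1, (hmem n _).2 e.2.2⟩
  · rw [Finset.mem_product, hmem, hmem] at hp
    exact ⟨⟨E.symm p, by simpa [biExp, E] using hp⟩, Finset.mem_univ _, E.apply_symm_apply p⟩

theorem glHom_monomial {d : SL3} {t : Fin 3 → ℂ} (hd : d.1 = Matrix.diagonal t)
    (hd' : (d⁻¹).1 = Matrix.diagonal t⁻¹) (e : Fin 3 ⊕ Fin 3 →₀ ℕ) :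
    glHom d (monomial e 1) =
      ((∏ i, t i ^ e (Sum.inl i)) * ∏ i, t⁻¹ i ^ e (Sum.inr i)) • monomial e 1 := by
  have hX : ∀ s, glHom d (X s) = (Sum.elim t t⁻¹ s) • X s := by
    rintro (k | k)
    · rw [glHom_X_inl, hd]; simp [Matrix.diagonal_apply]
    · rw [glHom_X_inr, hd']; simp [Matrix.diagonal_apply]
  rw [monomial_eq, Finsupp.prod_fintype _ _ fun s => pow_zero _]
  simp only [map_one, one_mul, map_prod, map_pow, hX, smul_pow, Finset.prod_smul]
  rw [Fintype.prod_sum_type]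
  rfl

/-- The character of the space of bihomogeneous polynomials, read off in the basis of
monomials. -/
theorem trace_glHom_biHom {d : SL3} {t : Fin 3 → ℂ} (hd : d.1 = Matrix.diagonal t)
    (hd' : (d⁻¹).1 = Matrix.diagonal t⁻¹) (m n : ℕ) :
    LinearMap.trace ℂ (biHom m n) ((glHom d).toLinearMap.restrict fun _ => glHom_mem_biHom d) =
      completeSymm t m * completeSymm t⁻¹ n := by
  classical
  have := (finite_biExp m n).fintype
  let b : Module.Basis (biExp m n) ℂ (biHom m n) := basisRestrictSupport ℂ (biExp m n)
  have hrepr : ∀ (f : biHom m n) (e : biExp m n), b.repr f e = coeff e.1 f.1 := fun _ _ => rfl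
  have hb : ∀ e, (b e).1 = monomial e.1 1 := fun e => by
    refine congrArg Subtype.val (a₂ := ⟨_, monomial_mem_biHom e.2⟩)
      (b.repr.injective (Finsupp.ext fun e' => ?_))
    rw [hrepr ⟨_, monomial_mem_biHom e.2⟩, Module.Basis.repr_self, coeff_monomial,
      Finsupp.single_apply]
    simp only [Subtype.ext_iff]
  rw [LinearMap.trace_eq_matrix_trace ℂ b, Matrix.trace, ← sum_biExp_prod]
  refine Finset.sum_congr rfl fun e _ => ?_
  rw [Matrix.diag_apply, LinearMap.toMatrix_apply]
  have : (glHom d).toLinearMap.restrict (fun _ => glHom_mem_biHom d) (b e) =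
      ((∏ i, t i ^ e.1 (Sum.inl i)) * ∏ i, t⁻¹ i ^ e.1 (Sum.inr i)) • b e :=
    Subtype.ext (by
      change glHom d (b e).1 = _ • (b e).1
      rw [hb]
      exact glHom_monomial hd hd' e.1)
  rw [this, map_smul, Module.Basis.repr_self]
  simp

/-- The character of the harmonic polynomials on a diagonal matrix, from the exact sequence which
the contraction gives. -/
theorem harmRep_character {d : SL3} {t : Fin 3 → ℂ} (hd : d.1 = Matrix.diagonal t)
    (hd' : (d⁻¹).1 = Matrix.diagonal t⁻¹) (m n : ℕ) :
    (harmRep m n).character d = weylChar t m n := by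
  let B : ∀ m n : ℕ, biHom m n →ₗ[ℂ] biHom m n := fun m n =>
    (glHom d).toLinearMap.restrict fun _ => glHom_mem_biHom d
  have htr : ∀ m n : ℕ, LinearMap.trace ℂ (biHom m n) (B m n) =
      completeSymm t m * completeSymm t⁻¹ n := trace_glHom_biHom hd hd'
  let ι : harm m n →ₗ[ℂ] biHom m n := Submodule.inclusion inf_le_left
  have hι : Function.Injective ι := Submodule.inclusion_injective _
  by_cases hmn : m = 0 ∨ n = 0
  · let φ : biHom m n →ₗ[ℂ] (⊥ : Submodule ℂ BiPoly) := 0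
    have h := LinearMap.trace_eq_add_of_exact (ι := ι) (φ := φ) (A := harmRep m n d) (B := B m n)
      (C := 0) hι (fun x => ⟨0, Subsingleton.elim _ _⟩) ?_ rfl (by simp [φ])
    · rw [htr, map_zero, add_zero] at h
      rw [Representation.character, ← h, weylChar]
      rcases hmn with rfl | rfl
      · have : completeSymm t (((0 : ℕ) : ℤ) - 1) = 0 := rfl
        rw [this, zero_mul, sub_zero]
      · have : completeSymm t⁻¹ (((0 : ℕ) : ℤ) - 1) = 0 := rfl
        rw [this, mul_zero, sub_zero]
    · refine (LinearMap.range_eq_top.2 fun f => ?_).trans LinearMap.ker_zero.symm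
      exact ⟨⟨f.1, Submodule.mem_inf.2
        ⟨f.2, LinearMap.mem_ker.2 (laplacian_eq_zero_of_mem_biHom f.2 hmn)⟩⟩, rfl⟩
  · push Not at hmn
    obtain ⟨m, rfl⟩ := Nat.exists_eq_succ_of_ne_zero hmn.1
    obtain ⟨n, rfl⟩ := Nat.exists_eq_succ_of_ne_zero hmn.2
    let φ : biHom (m + 1) (n + 1) →ₗ[ℂ] biHom m n :=
      laplacian.restrict fun _ => laplacian_mem_biHom
    have h := LinearMap.trace_eq_add_of_exact (ι := ι) (φ := φ)
      (A := harmRep (m + 1) (n + 1) d) (B := B (m + 1) (n + 1)) (C := B m n) hι ?_ ?_ rfl ?_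
    · rw [htr, htr] at h
      rw [Representation.character, weylChar]
      push_cast at h ⊢
      rw [add_sub_cancel_right, add_sub_cancel_right, h, add_sub_cancel_right]
    · intro f
      obtain ⟨u, hu, hf⟩ := biHom_le_map_laplacian m n f.2
      exact ⟨⟨u, hu⟩, Subtype.ext hf⟩
    · ext f
      refine ⟨?_, fun hf => ⟨⟨f.1, Submodule.mem_inf.2
        ⟨f.2, LinearMap.mem_ker.2 (congrArg Subtype.val hf)⟩⟩, rfl⟩⟩
      rintro ⟨u, rfl⟩
      exact Subtype.ext (LinearMap.mem_ker.1 (Submodule.mem_inf.1 u.2).2)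
    · exact LinearMap.ext fun f => Subtype.ext (laplacian_glHom d f.1)

end BiPoly

/-! ### Characters of the integrated representations and Pieri's rule -/

/-- At elements of finite order, which are of the form `exp X`, the character of an integrated
simple module depends only on its highest weight. -/
theorem HighestWeightRep.character_eq {m n : ℕ} (P Q : HighestWeightRep m n) {g : SL3}
    (hg : IsOfFinOrder g) : P.π.character g = Q.π.character g := by
  obtain ⟨A, hA⟩ := SL3.exists_exp_eq g hg
  obtain ⟨e, he⟩ := exists_linearEquiv_of_hasHighestWeight P.simple Q.simple P.hasHighestWeight
    Q.hasHighestWeight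
  have hconj : e.conj (LieModule.toEnd ℂ sl3 P.V A) = LieModule.toEnd ℂ sl3 Q.V A :=
    LinearMap.ext fun x => by
      rw [LinearEquiv.conj_apply_apply, LieModule.toEnd_apply_apply, he, e.apply_symm_apply,
        LieModule.toEnd_apply_apply]
  rw [Representation.character, Representation.character, P.integrates A g hA,
    Q.integrates A g hA, ← hconj, endExp_conj, LinearMap.trace_conj']

/-- All the characters involved are computed at an element of finite order from its eigenvalues
`t`: it is conjugate to `diag(t₀, t₁, t₂)`, and the model computes the characters there. -/
theorem SL3.exists_eigenvalues {g : SL3} (hg : IsOfFinOrder g) :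
    ∃ t : Fin 3 → ℂ, t 0 * t 1 * t 2 = 1 ∧ naturalRep.character g = ∑ i, t i ∧
      naturalRep.character g⁻¹ = ∑ i, (t i)⁻¹ ∧
      ∀ (m n : ℕ) (P : HighestWeightRep m n), P.π.character g = weylChar t m n := by
  obtain ⟨h, d, t, rfl, hd⟩ := SL3.exists_conj_diagonal g hg
  have ht : t 0 * t 1 * t 2 = 1 := by
    have := d.2
    rwa [show (d : Matrix (Fin 3) (Fin 3) ℂ) = d.1 from rfl, hd, Matrix.det_diagonal,
      Fin.prod_univ_three] at this
  have hinv : (d⁻¹).1 = Matrix.diagonal t⁻¹ := by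
    have h1 : (d⁻¹).1 * d.1 = 1 := by
      rw [← Matrix.SpecialLinearGroup.coe_mul, inv_mul_cancel]; rfl
    have h2 : d.1 * Matrix.diagonal t⁻¹ = 1 := by
      rw [hd, Matrix.diagonal_mul_diagonal, ← Matrix.diagonal_one]
      congr 1
      funext i
      refine mul_inv_cancel₀ fun h => ?_
      fin_cases i <;> simp_all
    exact left_inv_eq_right_inv h1 h2
  have hnat : ∀ g : SL3, naturalRep.character g = Matrix.trace g.1 := fun g =>
    Matrix.trace_toLin'_eq g.1
  refine ⟨t, ht, ?_, ?_, fun m n P => ?_⟩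
  · rw [Representation.char_conj, hnat, hd, Matrix.trace_diagonal]
  · rw [mul_inv_rev, mul_inv_rev, inv_inv, ← mul_assoc, Representation.char_conj, hnat, hinv,
      Matrix.trace_diagonal]
    rfl
  · rw [P.character_eq (harmonicRep m n) hg, Representation.char_conj]
    exact BiPoly.harmRep_character hd hinv m n

namespace IrrepList

variable {Γ : Subgroup SL3} {l : ℕ} (S : IrrepList Γ l)

/-- The character of `π_{a,b}` on `Γ` for `a, b ≥ 0`, and `0` when `a` or `b` is negative. Its
multiplicities are the entries of `multVec S P a b`. -/
noncomputable def levelCharacter (P : ∀ m n : ℕ, HighestWeightRep m n) (a b : ℤ) : Γ → ℂ :=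
  if 0 ≤ a ∧ 0 ≤ b then fun g => (P a.toNat b.toNat).π.character g else 0

theorem levelCharacter_eq_weylChar (P : ∀ m n : ℕ, HighestWeightRep m n) {g : Γ}
    {t : Fin 3 → ℂ} (h : ∀ (m n : ℕ) (P : HighestWeightRep m n),
      P.π.character g = weylChar t m n) (a b : ℤ) :
    levelCharacter P a b g = weylChar t a b := by
  by_cases hab : 0 ≤ a ∧ 0 ≤ b
  · rw [levelCharacter, if_pos hab, h, Int.toNat_of_nonneg hab.1, Int.toNat_of_nonneg hab.2]
  · rw [levelCharacter, if_neg hab, weylChar_of_neg t (by omega), Pi.zero_apply]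

theorem multVec_apply [Fintype Γ] (P : ∀ m n : ℕ, HighestWeightRep m n) (a b : ℤ)
    (i : Fin (l + 1)) : multVec S P a b i = S.pairing i (levelCharacter P a b) := by
  by_cases hab : 0 ≤ a ∧ 0 ≤ b
  · rw [multVec, levelCharacter, if_pos hab, if_pos hab, ← S.pairing_eq_mult]
    rfl
  · rw [multVec, levelCharacter, if_neg hab, if_neg hab, map_zero, Pi.zero_apply]

/-- Multiplying by the matrix of tensor multiplicities with `τ` multiplies characters by the
character of `τ`. -/
theorem mulVec_multVec [Fintype Γ] {U : Type} [AddCommGroup U] [Module ℂ U]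
    [FiniteDimensional ℂ U] (τ : Representation ℂ Γ U) (P : ∀ m n : ℕ, HighestWeightRep m n)
    (m n : ℕ) (i : Fin (l + 1)) :
    ((Matrix.of fun i j => S.mult ((S.γ j).tprod τ) i).map (Nat.cast : ℕ → ℂ) *ᵥ
      multVec S P m n) i = S.pairing i (levelCharacter P m n * τ.character) := by
  have h := S.sum_mult_tprod_mul_mult ((P m n).π.comp Γ.subtype) τ i
  have hpos : (0 : ℤ) ≤ m ∧ (0 : ℤ) ≤ n := ⟨Int.natCast_nonneg m, Int.natCast_nonneg n⟩
  rw [levelCharacter, multVec, if_pos hpos, if_pos hpos]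
  exact h

end IrrepList

theorem mainTheorem6 :
    (∀ m n : ℕ, Nonempty (HighestWeightRep m n)) ∧
    ∀ (P : ∀ m n : ℕ, HighestWeightRep m n)
      (Γ : Subgroup SL3) (_ : Finite Γ) (l : ℕ) (S : IrrepList Γ l) (m n : ℕ),
      ((A1 S).map (Nat.cast : ℕ → ℂ)) *ᵥ multVec S P m n =
          multVec S P (m + 1) n + multVec S P m (n - 1) + multVec S P (m - 1) (n + 1) ∧
      ((A2 S).map (Nat.cast : ℕ → ℂ)) *ᵥ multVec S P m n =
          multVec S P m (n + 1) + multVec S P (m - 1) n + multVec S P (m + 1) (n - 1) := by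
  refine ⟨fun m n => ⟨harmonicRep m n⟩, fun P Γ _ l S m n => ?_⟩
  have := Fintype.ofFinite Γ
  have hfin : ∀ g : Γ, IsOfFinOrder (g : SL3) := fun g =>
    Γ.subtype.isOfFinOrder (isOfFinOrder_of_finite g)
  constructor
  · funext i
    rw [Pi.add_apply, Pi.add_apply, S.multVec_apply, S.multVec_apply, S.multVec_apply, ← map_add,
      ← map_add]
    refine (S.mulVec_multVec (gammaRep Γ) P m n i).trans (congrArg _ (funext fun g => ?_))
    obtain ⟨t, ht, hγ, -, h⟩ := SL3.exists_eigenvalues (hfin g)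
    simp only [Pi.add_apply, Pi.mul_apply, IrrepList.levelCharacter_eq_weylChar P h]
    rw [← sum_mul_weylChar ht, ← hγ]
    rfl
  · funext i
    rw [Pi.add_apply, Pi.add_apply, S.multVec_apply, S.multVec_apply, S.multVec_apply, ← map_add,
      ← map_add]
    refine (S.mulVec_multVec (gammaRep Γ).dual P m n i).trans (congrArg _ (funext fun g => ?_))
    obtain ⟨t, ht, -, hγ, h⟩ := SL3.exists_eigenvalues (hfin g)
    simp only [Pi.add_apply, Pi.mul_apply, IrrepList.levelCharacter_eq_weylChar P h]
    rw [← sum_inv_mul_weylChar ht, ← hγ, Representation.char_dual]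
    rfl
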